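/- Let $(X,d)$ be a complete separable metric space, let $f:X\to X$ be continuous, and let $\mu$ be an $f$-invariant Borel probability measure on $X$. For $x\in X$, $n\in\mathbb N$ and $\varepsilon>0$, let $B(x,\varepsilon)$ be the open ball and $B(x,n,\varepsilon)=\{y\in X: d(f^i(x),f^i(y))<\varepsilon \text{ for } i=0,\dots,n\}$ the Bowen ball. The lower and upper local entropies of $(f,\mu)$ at $x$ are $$\underline h_\mu(f,x)=\lim_{\varepsilon\to0}\liminf_{n\to\infty}\frac{-\log\mu(B(x,n,\varepsilon))}{n},\qquad \overline h_\mu(f,x)=\lim_{\varepsilon\to0}\limsup_{n\to\infty}\frac{-\log\mu(B(x,n,\varepsilon))}{n}$$ (with $-\log 0=+\infty$), and the lower and upper local dimensions of $\mu$ at $x$ are $$\underline d_\mu(x)=\liminf_{\varepsilon\downarrow0}\frac{\log\mu(B(x,\varepsilon))}{\log\varepsilon},\qquad \overline d_\mu(x)=\limsup_{\varepsilon\downarrow0}\frac{\log\mu(B(x,\varepsilon))}{\log\varepsilon}$$ if $\mu(B(x,\varepsilon))>0$ for all $\varepsilon>0$, and $\underline d_\mu(x)=\overline d_\mu(x)=+\infty$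 otherwise. Let $h_\mu(f)$ be the metric (Kolmogorov–Sinai) entropy, and put $$\dim_H^-(\mu)=\inf\{\dim_H E: E \text{ Borel},\ \mu(E)>0\},\qquad \dim_P^+(\mu)=\inf\{\dim_P E: E \text{ Borel},\ \mu(X\setminus E)=0\},$$ where $\dim_H$ and $\dim_P$ are the Hausdorff and packing dimensions of a set. The packing dimension is $\dim_P E=\inf\{s\ge0: P^s(E)=0\}$, where $P^s(E)=\inf\{\sum_n P^s_0(A_n): E\subset\bigcup_n A_n\}$ (countable covers), and $P^s_0(A)$ is the limit as $\delta\downarrow0$ of the suprema of $\sum_i(2r_i)^s$ over at most countable families of pairwise disjoint closed balls with centres in $A$ and radii $0<r_i\le\delta/2$. (i) Suppose that there are $\Lambda>1$ and $\delta>0$ such that $d(f(x),f(y))\le\Lambda\,d(x,y)$ for all $x,y\in X$ with $d(x,y)<\delta$. Then, for every $x\in X$, $$\underline d_\mu(x)\ \ge\ \frac{\underline h_\mu(f,x)}{\log\Lambda}.$$ If moreover $\mu$ is ergodic, then $$\dim_H^-(\mu)\ \ge\ \frac{h_\mu(f)}{\log\Lambda}.$$ (ii) Suppose that there are $\lambda>1$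 and $\delta>0$ such that $\lambda\,d(x,y)\le d(f(x),f(y))$ for all $x,y\in X$ with $d(x,y)<\delta$. Then, for every $x\in X$, $$\overline d_\mu(x)\ \le\ \frac{\overline h_\mu(f,x)}{\log\lambda}.$$ If moreover $X$ is compact and $\mu$ is ergodic, then $$\dim_P^+(\mu)\ \le\ \frac{h_\mu(f)}{\log\lambda}.$$ -/

import Mathlib

open MeasureTheory Filter Topology Set
open scoped ENNReal NNReal

namespace InvariantMeasure

noncomputable section

/-! ### Dimensions of sets and of measures -/

/-- A `δ`-packing of `E`: an at most countable family of pairwise disjoint closed balls (recorded as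
pairs centre, radius), centred in `E`, with positive radii and with `2 r ≤ δ`. -/
def IsPacking {X : Type*} [MetricSpace X] (E : Set X) (δ : ℝ) (t : Set (X × ℝ)) : Prop :=
  t.Countable ∧ (∀ p ∈ t, p.1 ∈ E ∧ 0 < p.2 ∧ 2 * p.2 ≤ δ) ∧
    t.PairwiseDisjoint (fun p => Metric.closedBall p.1 p.2)

/-- The `s`-dimensional packing premeasure: the limit as `δ ↓ 0` (an infimum, by monotonicity) of
the suprema of `∑ (2 rᵢ) ^ s` over all `δ`-packings of `E`. -/
def packingPremeasure {X : Type*} [MetricSpace X] (s : ℝ≥0) (E : Set X) : ℝ≥0∞ :=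
  ⨅ (δ : ℝ) (_ : 0 < δ), ⨆ (t : Set (X × ℝ)) (_ : IsPacking E δ t),
    ∑' p : t, ENNReal.ofReal (2 * p.1.2) ^ (s : ℝ)

/-- The `s`-dimensional packing measure: the infimum of `∑ P₀ˢ(Aₙ)` over all countable covers
`(Aₙ)` of `E`. -/
def packingMeasure {X : Type*} [MetricSpace X] (s : ℝ≥0) (E : Set X) : ℝ≥0∞ :=
  ⨅ (A : ℕ → Set X) (_ : E ⊆ ⋃ n, A n), ∑' n, packingPremeasure s (A n)

/-- The packing dimension `inf {s ≥ 0 | Pˢ(E) = 0}` of a set. -/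
def dimP {X : Type*} [MetricSpace X] (E : Set X) : ℝ≥0∞ :=
  ⨅ (s : ℝ≥0) (_ : packingMeasure s E = 0), (s : ℝ≥0∞)

/-- The lower Hausdorff dimension `inf {dim_H E | E Borel, μ E > 0}` of a measure. -/
def lowerDimH {X : Type*} [MetricSpace X] [MeasurableSpace X] (μ : Measure X) : ℝ≥0∞ :=
  ⨅ (E : Set X) (_ : MeasurableSet E) (_ : 0 < μ E), dimH E

/-- The upper packing dimension `inf {dim_P E | E Borel, μ (X \ E) = 0}` of a measure. -/
def upperDimP {X : Type*} [MetricSpace X] [MeasurableSpace X] (μ : Measure X) : ℝ≥0∞ :=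
  ⨅ (E : Set X) (_ : MeasurableSet E) (_ : μ Eᶜ = 0), dimP E

/-! ### Local dimensions -/

open Classical in
/-- The lower local dimension of `μ` at `x`; it is `+∞` if some ball about `x` is a null set. -/
def lowerLocalDim {X : Type*} [MetricSpace X] [MeasurableSpace X] (μ : Measure X) (x : X) : EReal :=
  if ∀ ε : ℝ, 0 < ε → 0 < μ (Metric.ball x ε) then
    liminf (fun ε : ℝ => ENNReal.log (μ (Metric.ball x ε)) / (Real.log ε : EReal)) (𝓝[>] 0)
  else ⊤

open Classical in
/-- The upper local dimension of `μ` at `x`; it is `+∞` if some ball about `x` is a null set. -/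
def upperLocalDim {X : Type*} [MetricSpace X] [MeasurableSpace X] (μ : Measure X) (x : X) : EReal :=
  if ∀ ε : ℝ, 0 < ε → 0 < μ (Metric.ball x ε) then
    limsup (fun ε : ℝ => ENNReal.log (μ (Metric.ball x ε)) / (Real.log ε : EReal)) (𝓝[>] 0)
  else ⊤

/-! ### Local entropies -/

/-- The Bowen ball `B(x, n, ε)` of size `n` and radius `ε`; the times `0, …, n` are all used. -/
def bowenBall {X : Type*} [MetricSpace X] (f : X → X) (x : X) (n : ℕ) (ε : ℝ) : Set X :=
  {y | ∀ i ≤ n, dist (f^[i] x) (f^[i] y) < ε}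

/-- `liminf_n - log μ(B(x, n, ε)) / n`, with `- log 0 = +∞`. -/
def lowerLocalEntropyAt {X : Type*} [MetricSpace X] [MeasurableSpace X] (f : X → X)
    (μ : Measure X) (x : X) (ε : ℝ) : EReal :=
  liminf (fun n : ℕ => -ENNReal.log (μ (bowenBall f x n ε)) / (n : EReal)) atTop

/-- `limsup_n - log μ(B(x, n, ε)) / n`, with `- log 0 = +∞`. -/
def upperLocalEntropyAt {X : Type*} [MetricSpace X] [MeasurableSpace X] (f : X → X)
    (μ : Measure X) (x : X) (ε : ℝ) : EReal :=
  limsup (fun n : ℕ => -ENNReal.log (μ (bowenBall f x n ε)) / (n : EReal)) atTop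

/-- The lower local entropy: the limit of `lowerLocalEntropyAt f μ x ε` as `ε ↓ 0`. This quantity
is antitone in `ε`, so the limit is a supremum (see `tendsto_lowerLocalEntropyAt`). -/
def lowerLocalEntropy {X : Type*} [MetricSpace X] [MeasurableSpace X] (f : X → X)
    (μ : Measure X) (x : X) : EReal :=
  ⨆ (ε : ℝ) (_ : 0 < ε), lowerLocalEntropyAt f μ x ε

/-- The upper local entropy: the limit of `upperLocalEntropyAt f μ x ε` as `ε ↓ 0`. This quantity
is antitone in `ε`, so the limit is a supremum (see `tendsto_upperLocalEntropyAt`). -/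
def upperLocalEntropy {X : Type*} [MetricSpace X] [MeasurableSpace X] (f : X → X)
    (μ : Measure X) (x : X) : EReal :=
  ⨆ (ε : ℝ) (_ : 0 < ε), upperLocalEntropyAt f μ x ε

theorem neg_log_bowenBall_anti {X : Type*} [MetricSpace X] [MeasurableSpace X] (f : X → X)
    (μ : Measure X) (x : X) (n : ℕ) {ε ε' : ℝ} (h : ε ≤ ε') :
    -ENNReal.log (μ (bowenBall f x n ε')) / (n : EReal)
      ≤ -ENNReal.log (μ (bowenBall f x n ε)) / (n : EReal) := by
  refine EReal.div_le_div_right_of_nonneg (by exact_mod_cast n.zero_le) ?_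
  rw [EReal.neg_le_neg_iff]
  exact ENNReal.log_monotone (measure_mono fun y hy i hi => (hy i hi).trans_le h)

theorem tendsto_iSup_of_anti {g : ℝ → EReal} (hg : Antitone g) :
    Tendsto g (𝓝[>] 0) (𝓝 (⨆ (ε : ℝ) (_ : 0 < ε), g ε)) := by
  refine tendsto_order.2 ⟨fun a ha => ?_, fun a ha => ?_⟩
  · simp only [lt_iSup_iff] at ha
    obtain ⟨ε, hε, h⟩ := ha
    filter_upwards [Ioo_mem_nhdsGT hε] with r hr
    exact h.trans_le (hg hr.2.le)
  · filter_upwards [self_mem_nhdsWithin] with r hr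
    exact (le_iSup₂ (f := fun (ε : ℝ) (_ : 0 < ε) => g ε) r hr).trans_lt ha

theorem tendsto_lowerLocalEntropyAt {X : Type*} [MetricSpace X] [MeasurableSpace X] (f : X → X)
    (μ : Measure X) (x : X) :
    Tendsto (lowerLocalEntropyAt f μ x) (𝓝[>] 0) (𝓝 (lowerLocalEntropy f μ x)) :=
  tendsto_iSup_of_anti fun _ _ h =>
    liminf_le_liminf (Eventually.of_forall fun n => neg_log_bowenBall_anti f μ x n h)

theorem tendsto_upperLocalEntropyAt {X : Type*} [MetricSpace X] [MeasurableSpace X] (f : X → X)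
    (μ : Measure X) (x : X) :
    Tendsto (upperLocalEntropyAt f μ x) (𝓝[>] 0) (𝓝 (upperLocalEntropy f μ x)) :=
  tendsto_iSup_of_anti fun _ _ h =>
    limsup_le_limsup (Eventually.of_forall fun n => neg_log_bowenBall_anti f μ x n h)

/-! ### Metric (Kolmogorov–Sinai) entropy

A finite measurable partition is given by its labelling, a measurable map `ξ` into a finite
discrete type; its atoms are the fibres of `ξ`. -/

/-- The Shannon entropy `- ∑ μ(C) log μ(C)` over the atoms `C` of the partition `ξ`. -/
def partitionEntropy {X ι : Type*} [MeasurableSpace X] [Fintype ι] (μ : Measure X) (ξ : X → ι) :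
    ℝ :=
  ∑ i, Real.negMulLog (μ.real (ξ ⁻¹' {i}))

/-- The join `ξ ∨ f⁻¹ξ ∨ ⋯ ∨ f⁻⁽ⁿ⁻¹⁾ξ`. -/
def iteratedJoin {X ι : Type*} (f : X → X) (ξ : X → ι) (n : ℕ) : X → (Fin n → ι) :=
  fun x j => ξ (f^[(j : ℕ)] x)

/-- The entropy `lim_n (1/n) H(ξ ∨ ⋯ ∨ f⁻⁽ⁿ⁻¹⁾ξ)` of `f` relative to `ξ`. The limit exists for
every invariant probability measure, by subadditivity; it is written as a `limsup`. -/
def entropyOfPartition {X ι : Type*} [MeasurableSpace X] [Fintype ι] (f : X → X) (μ : Measure X)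
    (ξ : X → ι) : EReal :=
  limsup (fun n : ℕ => ((partitionEntropy μ (iteratedJoin f ξ n) / n : ℝ) : EReal)) atTop

/-- The metric entropy `h_μ(f)`: the supremum over all finite measurable partitions. -/
def metricEntropy {X : Type*} [MeasurableSpace X] (f : X → X) (μ : Measure X) : EReal :=
  ⨆ (k : ℕ) (ξ : X → Fin k) (_ : Measurable ξ), entropyOfPartition f μ ξ

end

end InvariantMeasure

/-! The pointwise inequalities compare balls with Bowen balls. If `f` expands small distances by at
most `Λ`, then `B(x, r)` lies in `B(x, n, ε)` as soon as `Λ ^ n * r ≤ ε`; if it expands them by at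
least `lam`, then `B(x, n, ε)` lies in `B(x, r)` as soon as `ε ≤ lam ^ n * r`. Choosing `n` close to
`log (ε / r)` divided by the logarithm of the rate turns exponential bounds in `n` for Bowen balls
into power bounds in `r` for balls.

The dimension inequalities then need two halves of a Brin–Katok theorem for ergodic `μ`. Below
`h_μ(f)`, some scale `ε` gives `μ(B(x, n, ε)) ≤ exp(-n c)` eventually, almost everywhere
(`exists_ae_eventually_bowenBall_le`). On a compact space, above `h_μ(f)`, every scale gives `exp(-n
t) ≤ μ(B(x, n, ε))` eventually, almost everywhere (`ae_eventually_exp_le_bowenBall`). Mass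
distribution principles for Hausdorff and packing measures finish the argument.

Both halves are proved by coding. From a nonnegative function `R` with total mass at most 1 on words
of each length, `mixCode R` is built: a sub-probability on words that cuts them into blocks, each a
single letter at cost `log (2 * card A)` or a word of length `n` at cost `-log R` plus a logarithmic
overhead. The cost `-log (mixCode R)` is therefore subadditive along orbits, up to these overheads.

For the first half, `R` averages over `y` the probability that a randomized reading of the orbit of
`y` produces a given word. A heavy Bowen ball about `x` makes `R` of the itinerary of `x` large.
Cutting orbits greedily at heavy times bounds the mean code length, and Gibbs' inequality bounds the
partition entropy by that mean.

For the second half, `R` is the cylinder measure itself. Cutting into blocks of one fixed length and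
averaging over the phases bounds the code length by a Birkhoff average. Borel–Cantelli shows that
cylinders are eventually not much lighter than the code predicts, which is the upper half of
Shannon–McMillan–Breiman. On a compact space a fine partition puts cylinders inside Bowen balls. -/

namespace InvariantMeasure

noncomputable section

/-! ### Sums over words and mixture codes -/

section Words

variable {A : Type*} [Fintype A]

/-- The sum of `F` over all words of length `n` in the alphabet `A`. -/
def wordSum : ℕ → (List A → ℝ) → ℝ
  | 0, F => F []
  | n + 1, F => ∑ a, wordSum n (fun u => F (a :: u))

theorem wordSum_congr {n : ℕ} {F G : List A → ℝ} (h : ∀ u, u.length = n → F u = G u) :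
    wordSum n F = wordSum n G := by
  induction n generalizing F G with
  | zero => exact h [] rfl
  | succ n ih => exact Finset.sum_congr rfl fun a _ => ih fun u hu => h _ (by simp [hu])

theorem wordSum_mono {n : ℕ} {F G : List A → ℝ} (h : ∀ u, u.length = n → F u ≤ G u) :
    wordSum n F ≤ wordSum n G := by
  induction n generalizing F G with
  | zero => exact h [] rfl
  | succ n ih => exact Finset.sum_le_sum fun a _ => ih fun u hu => h _ (by simp [hu])

theorem wordSum_append (n m : ℕ) (F : List A → ℝ) :
    wordSum (n + m) F = wordSum n (fun u => wordSum m (fun v => F (u ++ v))) := by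
  induction n generalizing F with
  | zero => simp [wordSum]
  | succ n ih =>
    rw [show n + 1 + m = (n + m) + 1 by omega]
    exact Finset.sum_congr rfl fun a _ => ih _

theorem wordSum_const_mul (n : ℕ) (c : ℝ) (F : List A → ℝ) :
    wordSum n (fun u => c * F u) = c * wordSum n F := by
  induction n generalizing F with
  | zero => rfl
  | succ n ih => simp only [wordSum, ih, Finset.mul_sum]

theorem wordSum_add (n : ℕ) (F G : List A → ℝ) :
    wordSum n (fun u => F u + G u) = wordSum n F + wordSum n G := by
  induction n generalizing F G with
  | zero => rfl
  | succ n ih => simp only [wordSum, ih, Finset.sum_add_distrib]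

theorem wordSum_sum {ι : Type*} (s : Finset ι) (n : ℕ) (F : ι → List A → ℝ) :
    wordSum n (fun u => ∑ i ∈ s, F i u) = ∑ i ∈ s, wordSum n (F i) := by
  induction n generalizing F with
  | zero => rfl
  | succ n ih => simp only [wordSum, ih]; exact Finset.sum_comm

theorem wordSum_const (n : ℕ) (c : ℝ) :
    wordSum n (fun _ : List A => c) = (Fintype.card A : ℝ) ^ n * c := by
  induction n with
  | zero => simp [wordSum]
  | succ n ih => simp only [wordSum, ih]; simp; ring

theorem wordSum_eq_sum (n : ℕ) (F : List A → ℝ) :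
    wordSum n F = ∑ a : Fin n → A, F (List.ofFn a) := by
  induction n generalizing F with
  | zero => simp [wordSum]
  | succ n ih =>
    simp only [wordSum, ih]
    rw [← Fintype.sum_prod_type' (f := fun (a : A) (v : Fin n → A) => F (a :: List.ofFn v))]
    exact Fintype.sum_equiv (Fin.consEquiv fun _ => A) _ _ fun p => by
      simp [Fin.consEquiv, List.ofFn_succ]

/-- The weight of a single block of the mixture code built on `R`: the block is either a letter
chosen uniformly, or a word of length `n`, chosen with probability `1 / (n (n + 1))`, with
weight `R`. -/
def blockWeight (R : List A → ℝ) (u : List A) : ℝ :=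
  (if u.length = 1 then 1 / (2 * Fintype.card A : ℝ) else 0) +
    (1 / (2 * (u.length * (u.length + 1)) : ℝ)) * R u

theorem blockWeight_nonneg {R : List A → ℝ} (hR : ∀ u, 0 ≤ R u) (u : List A) :
    0 ≤ blockWeight R u := by
  have := hR u
  unfold blockWeight
  split_ifs <;> positivity

/-- The length law `1 / (n (n + 1))` is kept as a telescoping difference, so that the totals over
all lengths visibly add up to at most 1. -/
theorem wordSum_blockWeight_le [Nonempty A] {R : List A → ℝ} (hR : ∀ n, wordSum n R ≤ 1) (n : ℕ) :
    wordSum (n + 1) (blockWeight R) ≤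
      (if n = 0 then 1 / 2 else 0) + (1 / (n + 1) - 1 / (n + 2) : ℝ) / 2 := by
  have hA : (Fintype.card A : ℝ) ≠ 0 := by exact_mod_cast Fintype.card_ne_zero
  rw [wordSum_congr (G := fun u => (if n = 0 then 1 / (2 * Fintype.card A : ℝ) else 0) +
    ((1 / (n + 1) - 1 / (n + 2) : ℝ) / 2) * R u), wordSum_add, wordSum_const, wordSum_const_mul]
  · have h2 : (0 : ℝ) ≤ (1 / (n + 1) - 1 / (n + 2) : ℝ) / 2 := by
      have : (1 / (n + 2) : ℝ) ≤ 1 / (n + 1) := by gcongr; norm_num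
      linarith
    have h3 := mul_le_mul_of_nonneg_left (hR (n + 1)) h2
    rcases Nat.eq_zero_or_pos n with rfl | hn
    · simp only [if_true]
      have h4 : (Fintype.card A : ℝ) ^ (0 + 1) * (1 / (2 * Fintype.card A)) = 1 / 2 := by
        rw [zero_add, pow_one]
        field_simp
      linarith
    · simp only [hn.ne', if_false]
      linarith
  · intro u hu
    unfold blockWeight
    rw [hu]
    push_cast
    have h4 : (1 / (2 * ((n + 1) * (n + 1 + 1))) : ℝ) = (1 / (n + 1) - 1 / (n + 2)) / 2 := by
      field_simp
      ring
    rw [h4]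

/-- The mixture code: a word is cut into random blocks, weighted by `blockWeight R`. -/
def mixCode (R : List A → ℝ) : ℕ → List A → ℝ
  | 0, _ => 1
  | N + 1, u => ∑ n : Fin (N + 1),
      blockWeight R (u.take (n + 1)) * mixCode R (N - n) (u.drop (n + 1))
  decreasing_by omega

theorem mixCode_nonneg {R : List A → ℝ} (hR : ∀ u, 0 ≤ R u) (N : ℕ) (u : List A) :
    0 ≤ mixCode R N u := by
  induction N using Nat.strong_induction_on generalizing u with
  | _ N ih =>
    cases N with
    | zero => simp [mixCode]
    | succ N =>
      rw [mixCode]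
      exact Finset.sum_nonneg fun n _ => mul_nonneg (blockWeight_nonneg hR _) (ih _ (by omega) _)

/-- This is a renewal argument: conditioned on the first block, the rest carries mass at most 1 by
induction, and the masses of the possible first blocks telescope to at most 1. -/
theorem wordSum_mixCode_le [Nonempty A] {R : List A → ℝ} (h0 : ∀ u, 0 ≤ R u)
    (hR : ∀ n, wordSum n R ≤ 1) (N : ℕ) : wordSum N (mixCode R N) ≤ 1 := by
  induction N using Nat.strong_induction_on with
  | _ N ih =>
    cases N with
    | zero => simp [mixCode, wordSum]
    | succ N =>
      have key : ∀ n : Fin (N + 1), wordSum (N + 1) (fun u : List A =>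
          blockWeight R (u.take (n + 1)) * mixCode R (N - n) (u.drop (n + 1))) ≤
          (if (n : ℕ) = 0 then 1 / 2 else 0) +
            (1 / ((n : ℕ) + 1) - 1 / ((n : ℕ) + 2) : ℝ) / 2 := by
        intro n
        refine le_trans ?_ (wordSum_blockWeight_le hR n)
        obtain ⟨n, hn⟩ := n
        obtain ⟨m, rfl⟩ := Nat.exists_eq_add_of_le (Nat.lt_succ_iff.1 hn)
        simp only [Nat.add_sub_cancel_left]
        rw [show n + m + 1 = (n + 1) + m by omega, wordSum_append]
        refine wordSum_mono fun u hu => ?_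
        rw [wordSum_congr (G := fun v => blockWeight R u * mixCode R m v),
          wordSum_const_mul]
        · exact mul_le_of_le_one_right (blockWeight_nonneg h0 _) (ih _ (by omega))
        · intro v _
          simp [← hu]
      rw [wordSum_congr (G := fun u => ∑ n : Fin (N + 1),
        blockWeight R (u.take (n + 1)) * mixCode R (N - n) (u.drop (n + 1)))
        (fun u _ => by rw [mixCode]), wordSum_sum]
      refine (Finset.sum_le_sum fun n _ => key n).trans ?_
      rw [Fin.sum_univ_eq_sum_range (fun n => (if n = 0 then (1 / 2 : ℝ) else 0) +
            (1 / ((n : ℕ) + 1) - 1 / ((n : ℕ) + 2) : ℝ) / 2), Finset.sum_add_distrib,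
        Finset.sum_ite_eq' (Finset.range (N + 1)) 0 (fun _ => (1 / 2 : ℝ)), ← Finset.sum_div]
      have := Finset.sum_range_sub' (fun n : ℕ => (1 / (n + 1) : ℝ)) (N + 1)
      have h2 : ∑ i ∈ Finset.range (N + 1), (1 / ((i : ℕ) + 1) - 1 / ((i : ℕ) + 2) : ℝ) =
          ∑ i ∈ Finset.range (N + 1), (1 / ((i : ℕ) + 1) - 1 / (((i + 1 : ℕ) : ℝ) + 1) : ℝ) :=
        Finset.sum_congr rfl fun i _ => by push_cast; ring
      rw [h2, this]
      have h3 : (0 : ℝ) ≤ 1 / (((N + 1 : ℕ) : ℝ) + 1) := by positivity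
      rw [if_pos (Finset.mem_range.2 N.succ_pos)]
      simp only [Nat.cast_zero, zero_add, div_one]
      linarith

/-- One admissible cutting takes `u` as its first block, so its term is a lower bound for the whole
sum. All subadditivity of the code length comes from here. -/
theorem blockWeight_mul_mixCode_le {R : List A → ℝ} (h0 : ∀ u, 0 ≤ R u) {n N : ℕ} (hn : 1 ≤ n)
    {u v : List A} (hu : u.length = n) :
    blockWeight R u * mixCode R N v ≤ mixCode R (N + n) (u ++ v) := by
  obtain ⟨n, rfl⟩ := Nat.exists_eq_add_of_le' hn
  rw [← add_assoc, mixCode]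
  have := Finset.single_le_sum (f := fun i : Fin (N + n + 1) =>
      blockWeight R ((u ++ v).take (i + 1)) * mixCode R (N + n - i) ((u ++ v).drop (i + 1)))
      (fun i _ => mul_nonneg (blockWeight_nonneg h0 _) (mixCode_nonneg h0 _ _))
      (Finset.mem_univ (⟨n, by omega⟩ : Fin (N + n + 1)))
  simpa [← hu] using this

end Words

/-! ### Itineraries -/

section Itineraries

variable {A X : Type*}

/-- The word of the labels of `x, f x, …, f^(n-1) x`. -/
def itinerary (f : X → X) (ξ : X → A) : ℕ → X → List A
  | 0, _ => []
  | n + 1, x => ξ x :: itinerary f ξ n (f x)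

@[simp] theorem length_itinerary (f : X → X) (ξ : X → A) (n : ℕ) (x : X) :
    (itinerary f ξ n x).length = n := by
  induction n generalizing x with
  | zero => rfl
  | succ n ih => simp [itinerary, ih]

theorem itinerary_add (f : X → X) (ξ : X → A) (n m : ℕ) (x : X) :
    itinerary f ξ (n + m) x = itinerary f ξ n x ++ itinerary f ξ m (f^[n] x) := by
  induction n generalizing x with
  | zero => simp [itinerary]
  | succ n ih =>
    rw [show n + 1 + m = (n + m) + 1 by omega]
    simp [itinerary, ih]

theorem itinerary_eq_ofFn (f : X → X) (ξ : X → A) (n : ℕ) (x : X) :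
    itinerary f ξ n x = List.ofFn (iteratedJoin f ξ n x) := by
  induction n generalizing x with
  | zero => simp [itinerary]
  | succ n ih =>
    rw [itinerary, ih, List.ofFn_succ]
    rfl

end Itineraries

/-! ### Code lengths of itineraries and their subadditivity along orbits -/

section CodeCost

variable {A X : Type*} [Fintype A]

/-- The cost `- log` of the itinerary of length `N` in the mixture code. -/
def codeCost (R : List A → ℝ) (f : X → X) (ξ : X → A) (N : ℕ) (x : X) : ℝ :=
  -Real.log (mixCode R N (itinerary f ξ N x))

theorem mixCode_pos [Nonempty A] {R : List A → ℝ} (h0 : ∀ u, 0 ≤ R u) (u : List A) :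
    0 < mixCode R u.length u := by
  induction u with
  | nil => simp [mixCode]
  | cons a u ih =>
    refine lt_of_lt_of_le (mul_pos ?_ ih)
      (blockWeight_mul_mixCode_le h0 le_rfl (u := [a]) (v := u) rfl)
    have := h0 [a]
    have : 0 < Fintype.card A := Fintype.card_pos
    simp only [blockWeight, List.length_singleton, if_true]
    positivity

theorem mixCode_itinerary_pos [Nonempty A] {R : List A → ℝ} (h0 : ∀ u, 0 ≤ R u) (f : X → X)
    (ξ : X → A) (N : ℕ) (x : X) : 0 < mixCode R N (itinerary f ξ N x) := by
  simpa using mixCode_pos h0 (itinerary f ξ N x)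

theorem codeCost_zero (R : List A → ℝ) (f : X → X) (ξ : X → A) (x : X) :
    codeCost R f ξ 0 x = 0 := by
  simp [codeCost, mixCode]

theorem codeCost_add_le_of_blockWeight [Nonempty A] {R : List A → ℝ} (h0 : ∀ u, 0 ≤ R u)
    (f : X → X) (ξ : X → A) {n : ℕ} (hn : 1 ≤ n) (N : ℕ) (x : X)
    (h : 0 < blockWeight R (itinerary f ξ n x)) :
    codeCost R f ξ (N + n) x ≤
      -Real.log (blockWeight R (itinerary f ξ n x)) + codeCost R f ξ N (f^[n] x) := by
  have h1 := mixCode_itinerary_pos h0 f ξ N (f^[n] x)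
  rw [codeCost, codeCost, ← neg_add, ← Real.log_mul h.ne' h1.ne', neg_le_neg_iff, add_comm N,
    itinerary_add, add_comm n]
  exact Real.log_le_log (mul_pos h h1) (blockWeight_mul_mixCode_le h0 hn (by simp))

theorem codeCost_succ_le [Nonempty A] {R : List A → ℝ} (h0 : ∀ u, 0 ≤ R u)
    (f : X → X) (ξ : X → A) (N : ℕ) (x : X) :
    codeCost R f ξ (N + 1) x ≤ Real.log (2 * Fintype.card A) + codeCost R f ξ N (f x) := by
  have hA : (0 : ℝ) < Fintype.card A := by exact_mod_cast Fintype.card_pos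
  have h1 : 1 / (2 * Fintype.card A : ℝ) ≤ blockWeight R (itinerary f ξ 1 x) := by
    have := h0 (itinerary f ξ 1 x)
    simp only [blockWeight, length_itinerary, if_true, le_add_iff_nonneg_right]
    positivity
  have h2 : 0 < 1 / (2 * Fintype.card A : ℝ) := by positivity
  refine (codeCost_add_le_of_blockWeight h0 f ξ le_rfl N x (h2.trans_le h1)).trans ?_
  have := Real.log_le_log h2 h1
  rw [one_div, Real.log_inv] at this
  simpa using (by linarith : -Real.log (blockWeight R (itinerary f ξ 1 x)) ≤ _)

theorem codeCost_add_le [Nonempty A] {R : List A → ℝ} (h0 : ∀ u, 0 ≤ R u)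
    (f : X → X) (ξ : X → A) {n : ℕ} (hn : 1 ≤ n) (N : ℕ) (x : X)
    (h : 0 < R (itinerary f ξ n x)) :
    codeCost R f ξ (N + n) x ≤ Real.log (2 * (n * (n + 1))) - Real.log (R (itinerary f ξ n x))
      + codeCost R f ξ N (f^[n] x) := by
  have hn' : (0 : ℝ) < n := by exact_mod_cast hn
  have h1 : 1 / (2 * (n * (n + 1)) : ℝ) * R (itinerary f ξ n x) ≤
      blockWeight R (itinerary f ξ n x) := by
    simp only [blockWeight, length_itinerary, le_add_iff_nonneg_left]
    split_ifs <;> positivity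
  have h2 : 0 < 1 / (2 * (n * (n + 1)) : ℝ) * R (itinerary f ξ n x) := by positivity
  refine (codeCost_add_le_of_blockWeight h0 f ξ hn N x (h2.trans_le h1)).trans ?_
  have := Real.log_le_log h2 h1
  rw [Real.log_mul (by positivity) h.ne', one_div, Real.log_inv] at this
  linarith

end CodeCost

/-! ### Greedy decompositions of orbits and the pointwise ergodic theorem -/

section Greedy

variable {X : Type*}

/-- Read the orbit from left to right: at a point of `A` jump over a good block, at a point outside
`A` take one step and pay the surcharge `C`. When fewer than `m` symbols remain, single steps cost
at most `C * m` extra. -/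
theorem le_birkhoffSum_of_greedy {f : X → X} {θ : ℕ → X → ℝ} {G : X → ℝ} {C : ℝ} (hC : 0 ≤ C)
    {A : Set X} {m : ℕ} (h0 : ∀ x, θ 0 x ≤ 0)
    (hstep : ∀ N x, θ (N + 1) x ≤ G x + C + θ N (f x))
    (hA : ∀ x ∈ A, ∃ n, 1 ≤ n ∧ n ≤ m ∧
      ∀ N, θ (N + n) x ≤ birkhoffSum f G n x + θ N (f^[n] x)) (N : ℕ) (x : X) :
    θ N x ≤ birkhoffSum f (fun y => G y + Aᶜ.indicator (fun _ => C) y) N x + C * m := by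
  set D : X → ℝ := fun y => G y + Aᶜ.indicator (fun _ => C) y with hD
  have hGD : ∀ n y, birkhoffSum f G n y ≤ birkhoffSum f D n y := fun n y =>
    Finset.sum_le_sum fun i _ => le_add_of_nonneg_right (indicator_nonneg (fun _ _ => hC) _)
  have hshort : ∀ N x, θ N x ≤ birkhoffSum f G N x + C * N := by
    intro N
    induction N with
    | zero => intro x; simpa using h0 x
    | succ N ih =>
      intro x
      have h1 := hstep N x
      have h2 := ih (f x)
      rw [birkhoffSum_succ']
      push_cast
      linarith
  induction N using Nat.strong_induction_on generalizing x with
  | _ N ih =>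
    rcases lt_or_ge N m with hN | hN
    · have h1 := hshort N x
      have h2 := hGD N x
      have h3 : C * N ≤ C * m := by gcongr
      linarith
    · rcases Nat.eq_zero_or_pos N with rfl | hpos
      · have := hshort 0 x
        have h2 := hGD 0 x
        have h3 : C * (0 : ℕ) ≤ C * m := by gcongr; exact Nat.zero_le m
        linarith
      by_cases hx : x ∈ A
      · obtain ⟨n, hn1, hnm, hn⟩ := hA x hx
        obtain ⟨k, rfl⟩ := Nat.exists_eq_add_of_le (hnm.trans hN)
        have h1 := hn k
        have h2 := ih k (by omega) (f^[n] x)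
        have h3 := hGD n x
        rw [add_comm k n] at h1
        rw [birkhoffSum_add]
        linarith
      · obtain ⟨k, rfl⟩ := Nat.exists_eq_add_of_le' hpos
        have h1 := hstep k x
        have h2 := ih k (by omega) (f x)
        have h3 : D x = G x + C := by simp [hD, hx]
        rw [birkhoffSum_succ']
        linarith

/-- Blocks of fixed length `m` can start at any of `m` phases. Summing the resulting bounds over the
phases uses each time as a block start at most once, which produces the Birkhoff sum of `g`. -/
theorem mul_le_birkhoffSum_of_blocks {f : X → X} {θ : ℕ → X → ℝ} {g : X → ℝ} {C : ℝ} (hC : 0 ≤ C)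
    (hg : ∀ x, 0 ≤ g x) {m : ℕ} (hm : 1 ≤ m) (h0 : ∀ x, θ 0 x ≤ 0)
    (hstep : ∀ N x, θ (N + 1) x ≤ C + θ N (f x))
    (hblock : ∀ N x, θ (N + m) x ≤ g x + θ N (f^[m] x)) (N : ℕ) (x : X) :
    m * θ N x ≤ birkhoffSum f g N x + 2 * m ^ 2 * C := by
  have hshort : ∀ N x, θ N x ≤ C * N := by
    intro N
    induction N with
    | zero => intro x; simpa using h0 x
    | succ N ih =>
      intro x
      have h1 := hstep N x
      have h2 := ih (f x)
      push_cast
      linarith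
  have hnn : ∀ (p : Prop) [Decidable p] (y : X), 0 ≤ if p then g y else 0 := fun p _ y => by
    split_ifs
    exacts [hg y, le_rfl]
  -- Phase `j`: read `j` single letters, then blocks of length `m`, which start at times congruent
  -- to `j` modulo `m`. The initial letters and the unfinished last block cost at most `(j + m) *
  -- C`.
  have key : ∀ M j : ℕ, j < m → ∀ x, θ M x ≤
      ∑ i ∈ Finset.range M, (if i % m = j then g (f^[i] x) else 0) + (j + m) * C := by
    intro M
    induction M using Nat.strong_induction_on with
    | _ M ih =>
      intro j hj x
      rcases lt_or_ge M m with hM | hM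
      · have h1 := hshort M x
        have h2 : 0 ≤ ∑ i ∈ Finset.range M, (if i % m = j then g (f^[i] x) else 0) :=
          Finset.sum_nonneg fun i _ => hnn _ _
        have h3 : C * M ≤ C * m := by gcongr
        have h4 : 0 ≤ j * C := by positivity
        linarith
      · rcases Nat.eq_zero_or_pos j with rfl | hj0
        · obtain ⟨k, rfl⟩ := Nat.exists_eq_add_of_le hM
          have h1 := hblock k x
          have h2 := ih k (by omega) 0 hj (f^[m] x)
          rw [Finset.sum_range_add]
          have h3 : g x ≤ ∑ i ∈ Finset.range m, (if i % m = 0 then g (f^[i] x) else 0) :=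
            (le_of_eq (by simp)).trans (Finset.single_le_sum
              (f := fun i => if i % m = 0 then g (f^[i] x) else 0)
              (fun i _ => hnn _ _) (Finset.mem_range.2 hm))
          have h4 : ∑ i ∈ Finset.range k, (if (m + i) % m = 0 then g (f^[m + i] x) else 0) =
              ∑ i ∈ Finset.range k, (if i % m = 0 then g (f^[i] (f^[m] x)) else 0) :=
            Finset.sum_congr rfl fun i _ => by
              rw [Nat.add_mod_left, add_comm m i, Function.iterate_add_apply]
          rw [add_comm k m] at h1
          rw [h4]
          linarith
        · obtain ⟨k, rfl⟩ := Nat.exists_eq_add_of_le' (hm.trans hM)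
          obtain ⟨l, rfl⟩ := Nat.exists_eq_add_of_le' hj0
          have h1 := hstep k x
          have h2 := ih k (by omega) l (by omega) (f x)
          rw [Finset.sum_range_succ']
          have h4 : ∑ i ∈ Finset.range k, (if i % m = l then g (f^[i] (f x)) else 0) ≤
              ∑ i ∈ Finset.range k, (if (i + 1) % m = l + 1 then g (f^[i + 1] x) else 0) := by
            refine Finset.sum_le_sum fun i _ => ?_
            by_cases h : i % m = l
            · rw [if_pos h, if_pos (by rw [Nat.add_mod, h, Nat.mod_eq_of_lt
                (show 1 < m by omega), Nat.mod_eq_of_lt hj]), Function.iterate_succ_apply]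
            · rw [if_neg h]
              exact hnn _ _
          have h5 := hnn (0 % m = l + 1) (f^[0] x)
          push_cast
          linarith
  have hsum := Finset.sum_le_sum fun j (hj : j ∈ Finset.range m) =>
    key N j (Finset.mem_range.1 hj) x
  rw [Finset.sum_const, Finset.card_range, nsmul_eq_mul, Finset.sum_add_distrib,
    Finset.sum_comm] at hsum
  have h1 : ∑ i ∈ Finset.range N, ∑ j ∈ Finset.range m, (if i % m = j then g (f^[i] x) else 0) =
      birkhoffSum f g N x := by
    refine Finset.sum_congr rfl fun i _ => ?_
    rw [Finset.sum_ite_eq, if_pos (Finset.mem_range.2 (Nat.mod_lt _ hm))]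
  have h2 : ∑ j ∈ Finset.range m, ((j : ℝ) + m) * C ≤ ∑ j ∈ Finset.range m, (2 * m) * C := by
    refine Finset.sum_le_sum fun j hj => ?_
    have : (j : ℝ) ≤ m := by exact_mod_cast (Finset.mem_range.1 hj).le
    gcongr
    linarith
  rw [Finset.sum_const, Finset.card_range, nsmul_eq_mul] at h2
  rw [h1] at hsum
  linarith

variable [MeasurableSpace X] {f : X → X} {μ : Measure X}

theorem integrable_birkhoffSum (hf : MeasurePreserving f μ μ) {G : X → ℝ} (hG : Integrable G μ)
    (N : ℕ) : Integrable (birkhoffSum f G N) μ := by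
  change Integrable (fun x => ∑ i ∈ Finset.range N, G (f^[i] x)) μ
  exact integrable_finsetSum _ fun i _ => (hf.iterate i).integrable_comp_of_integrable hG

theorem integral_birkhoffSum (hf : MeasurePreserving f μ μ) {G : X → ℝ} (hG : Integrable G μ)
    (N : ℕ) : ∫ x, birkhoffSum f G N x ∂μ = N * ∫ x, G x ∂μ := by
  have hi : ∀ i ∈ Finset.range N, Integrable (fun x => G (f^[i] x)) μ := fun i _ =>
    (hf.iterate i).integrable_comp_of_integrable hG
  simp only [birkhoffSum]
  rw [integral_finsetSum _ hi,
    Finset.sum_congr rfl (g := fun _ => ∫ x, G x ∂μ), Finset.sum_const, Finset.card_range,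
    nsmul_eq_mul]
  intro i _
  have h := hf.iterate i
  rw [← integral_map (f := G) h.measurable.aemeasurable (h.map_eq.symm ▸ hG.1), h.map_eq]

theorem exists_measureReal_forall_not_lt [IsFiniteMeasure μ] {P : ℕ → X → Prop}
    (hP : ∀ n, MeasurableSet {x | P n x}) (h : ∀ᵐ x ∂μ, ∃ n, P n x) {η : ℝ} (hη : 0 < η) :
    ∃ m : ℕ, μ.real {x | ∃ n ≤ m, P n x}ᶜ < η := by
  have hmeas : ∀ m : ℕ, MeasurableSet {x | ∃ n ≤ m, P n x} := fun m => by
    have : {x | ∃ n ≤ m, P n x} = ⋃ n ≤ m, {x | P n x} := by ext; simp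
    rw [this]
    exact .iUnion fun n => .iUnion fun _ => hP n
  have ht := tendsto_measure_iInter_atTop (μ := μ) (s := fun m : ℕ => {x | ∃ n ≤ m, P n x}ᶜ)
    (fun m => (hmeas m).compl.nullMeasurableSet)
    (fun a b hab => compl_subset_compl.2 fun x ⟨n, hn, hx⟩ => ⟨n, hn.trans hab, hx⟩)
    ⟨0, measure_ne_top _ _⟩
  have h0 : μ (⋂ m : ℕ, {x | ∃ n ≤ m, P n x}ᶜ) = 0 := by
    refine measure_mono_null ?_ h
    intro x hx ⟨n, hn⟩
    exact mem_iInter.1 hx n ⟨n, le_rfl, hn⟩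
  rw [h0] at ht
  have ht' := (ENNReal.tendsto_toReal ENNReal.zero_ne_top).comp ht
  exact (ht'.eventually (gt_mem_nhds hη)).exists

/-- Good times exist almost everywhere, so outside a set of small measure one occurs before a
uniform bound `m`. Integrating the greedy estimate, the surcharge is proportional to the measure of
that set, and the boundary term `C * m` is negligible against `N`. -/
theorem eventually_integral_le_of_greedy [IsProbabilityMeasure μ] (hf : MeasurePreserving f μ μ)
    {θ : ℕ → X → ℝ} (hθ : ∀ N, Integrable (θ N) μ) {G : X → ℝ} (hG : Integrable G μ) {C : ℝ}
    (hC : 0 ≤ C) {P : ℕ → X → Prop} (hP : ∀ n, MeasurableSet {x | P n x})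
    (hex : ∀ᵐ x ∂μ, ∃ n, P n x) (h0 : ∀ x, θ 0 x ≤ 0)
    (hstep : ∀ N x, θ (N + 1) x ≤ G x + C + θ N (f x))
    (hgood : ∀ n x, P n x → 1 ≤ n ∧ ∀ N, θ (N + n) x ≤ birkhoffSum f G n x + θ N (f^[n] x))
    {η : ℝ} (hη : 0 < η) : ∀ᶠ N : ℕ in atTop, ∫ x, θ N x ∂μ ≤ N * (∫ x, G x ∂μ + η) := by
  obtain ⟨m, hm⟩ := exists_measureReal_forall_not_lt hP hex
    (show 0 < η / (2 * (C + 1)) by positivity)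
  set A : Set X := {x | ∃ n ≤ m, P n x} with hAdef
  have hmeas : MeasurableSet A := by
    have : A = ⋃ n ≤ m, {x | P n x} := by ext; simp [hAdef]
    rw [this]
    exact .iUnion fun n => .iUnion fun _ => hP n
  have hI : Integrable (Aᶜ.indicator fun _ => C) μ := (integrable_const C).indicator hmeas.compl
  have hbound : ∀ N : ℕ, ∫ x, θ N x ∂μ ≤ N * (∫ x, G x ∂μ + C * μ.real Aᶜ) + C * m := by
    intro N
    have h1 := integral_mono (hθ N)
      ((integrable_birkhoffSum hf (hG.add hI) N).add (integrable_const (C * m)))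
      (le_birkhoffSum_of_greedy hC h0 hstep
        (A := A) (m := m)
        (fun x ⟨n, hn, hx⟩ => ⟨n, (hgood n x hx).1, hn, (hgood n x hx).2⟩) N)
    refine h1.trans (le_of_eq ?_)
    simp only [Pi.add_apply]
    rw [integral_add (integrable_birkhoffSum hf (hG.add hI) N) (integrable_const _),
      integral_birkhoffSum hf (hG.add hI)]
    simp only [Pi.add_apply]
    rw [integral_add hG hI, integral_indicator_const _ hmeas.compl]
    simp [mul_comm]
  have hCη : C * μ.real Aᶜ ≤ η / 2 := by
    have : C * μ.real Aᶜ ≤ (C + 1) * (η / (2 * (C + 1))) := by gcongr; linarith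
    refine this.trans (le_of_eq ?_)
    field_simp
  obtain ⟨N0, hN0⟩ := exists_nat_gt (C * m / (η / 2))
  filter_upwards [eventually_ge_atTop N0] with N hN
  have h1 : C * m < N0 * (η / 2) := (div_lt_iff₀ (by positivity)).1 hN0
  have h2 : (N0 : ℝ) * (η / 2) ≤ N * (η / 2) := by gcongr
  have h3 : (N : ℝ) * (C * μ.real Aᶜ) ≤ N * (η / 2) := by gcongr
  have := hbound N
  linarith

/-- The upper half of the pointwise ergodic theorem for bounded functions. -/
theorem ae_eventually_birkhoffSum_le [IsProbabilityMeasure μ] (hf : Ergodic f μ) {φ : X → ℝ}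
    (hφ : Measurable φ) {B : ℝ} (hB : ∀ x, |φ x| ≤ B) {t : ℝ} (ht : ∫ x, φ x ∂μ < t) :
    ∀ᵐ x ∂μ, ∀ᶠ n : ℕ in atTop, birkhoffSum f φ n x ≤ n * t := by
  have hmp := hf.toMeasurePreserving
  have hB0 : 0 ≤ B := by
    have : Nonempty X := nonempty_of_isProbabilityMeasure μ
    exact (abs_nonneg _).trans (hB (Classical.arbitrary X))
  have hint : Integrable φ μ := Integrable.of_bound hφ.aestronglyMeasurable B
    (Eventually.of_forall hB)
  have hsum : ∀ n, Measurable (birkhoffSum f φ n) := fun n => by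
    change Measurable (fun x => ∑ i ∈ Finset.range n, φ (f^[i] x))
    exact Finset.measurable_fun_sum _ fun i _ => hφ.comp (hmp.measurable.iterate i)
  obtain ⟨t', htt', ht't⟩ := exists_between ht
  -- The slack `1 / (m + 1)` with variable `m` makes `E ⊆ f ⁻¹' E`: dropping the first summand
  -- changes the sum by a bounded amount, which the gap between the slacks for `m` and `m + 1`
  -- absorbs at large times.
  set E : Set X := {x | ∃ m : ℕ, ∃ᶠ n : ℕ in atTop,
    (n : ℝ) * (t' + 1 / (m + 1)) < birkhoffSum f φ n x} with hE
  have hEmeas : MeasurableSet E := by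
    have : E = ⋃ m : ℕ, ⋂ a : ℕ, ⋃ b : ℕ, ⋃ (_ : a ≤ b),
        {x | (b : ℝ) * (t' + 1 / (m + 1)) < birkhoffSum f φ b x} := by
      ext x
      simp [hE, frequently_atTop]
    rw [this]
    exact .iUnion fun m => .iInter fun a => .iUnion fun b => .iUnion fun _ =>
      measurableSet_lt measurable_const (hsum b)
  have hEinv : E ⊆ f ⁻¹' E := by
    rintro x ⟨m, hm⟩
    refine ⟨m + 1, ?_⟩
    have hd : (0 : ℝ) < 1 / (m + 1) - 1 / ((m + 1 : ℕ) + 1) := by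
      rw [sub_pos]
      push_cast
      gcongr
      linarith
    obtain ⟨N0, hN0⟩ := exists_nat_gt
      ((B + |t' + 1 / (m + 1)|) / (1 / (m + 1) - 1 / ((m + 1 : ℕ) + 1)))
    rw [div_lt_iff₀ hd] at hN0
    rw [frequently_atTop] at hm ⊢
    intro a
    obtain ⟨b, hb, hbx⟩ := hm (a + N0 + 1)
    obtain ⟨c, rfl⟩ : ∃ c, b = c + 1 := ⟨b - 1, by omega⟩
    refine ⟨c, by omega, ?_⟩
    rw [birkhoffSum_succ'] at hbx
    have h1 := (abs_le.1 (hB x)).2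
    have h2 := neg_abs_le (t' + 1 / (m + 1))
    have h3 : (N0 : ℝ) * (1 / (m + 1) - 1 / ((m + 1 : ℕ) + 1)) ≤
      c * (1 / (m + 1) - 1 / ((m + 1 : ℕ) + 1)) := by
      gcongr
      omega
    push_cast at *
    nlinarith
  rcases hf.ae_empty_or_univ_of_ae_le_preimage hEmeas.nullMeasurableSet
    (Eventually.of_forall hEinv) with h | h
  · rw [eventuallyEq_empty] at h
    filter_upwards [h] with x hx
    simp only [hE, mem_ofPred_eq, not_exists, not_frequently, not_lt] at hx
    obtain ⟨m, hm⟩ := exists_nat_one_div_lt (sub_pos.2 ht't)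
    filter_upwards [hx m] with n hn
    refine hn.trans ?_
    gcongr
    linarith
  · exfalso
    rw [eventuallyEq_univ] at h
    -- If `E` had full measure, cutting orbits greedily into stretches with average above `t'` would
    -- force `∫ φ ≥ t' - η` for every `η > 0`, contradicting `∫ φ < t'`.
    have key := fun {η : ℝ} (hη : 0 < η) => eventually_integral_le_of_greedy hmp
      (θ := fun n x => - birkhoffSum f φ n x) (fun N => (integrable_birkhoffSum hmp hint N).neg)
      (G := fun _ => -t') (integrable_const _) (C := B + |t'|) (by positivity)
      (P := fun n x => 1 ≤ n ∧ n * t' < birkhoffSum f φ n x)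
      (fun n => (MeasurableSet.const _).inter (measurableSet_lt measurable_const (hsum n)))
      (by
        filter_upwards [h] with x ⟨m, hm⟩
        obtain ⟨n, hn, hn1⟩ := (hm.and_eventually (eventually_ge_atTop 1)).exists
        refine ⟨n, hn1, lt_of_le_of_lt ?_ hn⟩
        gcongr
        simp
        positivity)
      (fun x => by simp)
      (fun N x => by
        rw [birkhoffSum_succ']
        have h1 := (abs_le.1 (hB x)).1
        have h2 := le_abs_self t'
        linarith)
      (fun n x ⟨hn, hx⟩ => ⟨hn, fun N => by
        rw [add_comm N n, birkhoffSum_add]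
        have : birkhoffSum f (fun _ => -t') n x = n * -t' := by simp [birkhoffSum]
        rw [this]
        linarith⟩) hη
    obtain ⟨N, hN, hN1⟩ := ((key (half_pos (sub_pos.2 htt'))).and (eventually_ge_atTop 1)).exists
    rw [integral_neg, integral_birkhoffSum hmp hint] at hN
    simp only [integral_const, probReal_univ, one_smul] at hN
    have hN' : (1 : ℝ) ≤ N := by exact_mod_cast hN1
    nlinarith

end Greedy

/-! ### Distributions of itineraries -/

theorem exists_abs_comp_itinerary_le {A X : Type*} [Fintype A] (f : X → X) (ξ : X → A) (n : ℕ)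
    (F : List A → ℝ) :
    ∃ B, ∀ x, |F (itinerary f ξ n x)| ≤ B := by
  refine ⟨∑ a : Fin n → A, |F (List.ofFn a)|, fun x => ?_⟩
  rw [itinerary_eq_ofFn]
  exact Finset.single_le_sum (f := fun a : Fin n → A => |F (List.ofFn a)|)
    (fun _ _ => abs_nonneg _) (Finset.mem_univ _)

section ItineraryLaw

variable {A X : Type*} [MeasurableSpace A] [MeasurableSpace X] {f : X → X} {ξ : X → A}

theorem measurable_iteratedJoin (hf : Measurable f) (hξ : Measurable ξ) (n : ℕ) :
    Measurable (iteratedJoin f ξ n) :=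
  measurable_pi_lambda _ fun j => hξ.comp (hf.iterate j)

variable [Fintype A] [MeasurableSingletonClass A]

theorem measurable_comp_itinerary {β : Type*} [MeasurableSpace β] (hf : Measurable f)
    (hξ : Measurable ξ) (n : ℕ) (F : List A → β) :
    Measurable fun x => F (itinerary f ξ n x) := by
  simp only [itinerary_eq_ofFn]
  exact (measurable_of_finite (fun a : Fin n → A => F (List.ofFn a))).comp
    (measurable_iteratedJoin hf hξ n)

variable {μ : Measure X} [IsProbabilityMeasure μ]

theorem integrable_comp_itinerary (hf : Measurable f) (hξ : Measurable ξ) (n : ℕ)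
    (F : List A → ℝ) : Integrable (fun x => F (itinerary f ξ n x)) μ := by
  obtain ⟨B, hB⟩ := exists_abs_comp_itinerary_le f ξ n F
  exact Integrable.of_bound (measurable_comp_itinerary hf hξ n F).aestronglyMeasurable B
    (Eventually.of_forall hB)

theorem integral_comp_itinerary (hf : Measurable f) (hξ : Measurable ξ) (n : ℕ)
    (F : List A → ℝ) : ∫ x, F (itinerary f ξ n x) ∂μ =
      ∑ a : Fin n → A, μ.real (iteratedJoin f ξ n ⁻¹' {a}) * F (List.ofFn a) := by
  have hm := measurable_iteratedJoin hf hξ n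
  have h1 := integral_map (μ := μ) hm.aemeasurable
    (f := fun a : Fin n → A => F (List.ofFn a)) (measurable_of_finite _).aestronglyMeasurable
  have : IsProbabilityMeasure (μ.map (iteratedJoin f ξ n)) :=
    Measure.isProbabilityMeasure_map hm.aemeasurable
  simp only [itinerary_eq_ofFn]
  rw [← h1, integral_fintype (Integrable.of_finite)]
  refine Finset.sum_congr rfl fun a _ => ?_
  rw [map_measureReal_apply hm (MeasurableSet.singleton a), smul_eq_mul]

theorem sum_measureReal_iteratedJoin (hf : Measurable f) (hξ : Measurable ξ) (n : ℕ) :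
    ∑ a : Fin n → A, μ.real (iteratedJoin f ξ n ⁻¹' {a}) = 1 := by
  have := integral_comp_itinerary (μ := μ) hf hξ n (fun _ => 1)
  simpa using this.symm

/-- The Gibbs inequality for the law of the itinerary of length `n`. -/
theorem partitionEntropy_le_integral (hf : Measurable f) (hξ : Measurable ξ) (n : ℕ)
    {Q : List A → ℝ} (hQ : ∀ u, u.length = n → 0 < Q u) (hsum : wordSum n Q ≤ 1) :
    partitionEntropy μ (iteratedJoin f ξ n) ≤ ∫ x, -Real.log (Q (itinerary f ξ n x)) ∂μ := by
  rw [integral_comp_itinerary hf hξ n (fun u => -Real.log (Q u)), partitionEntropy]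
  rw [wordSum_eq_sum] at hsum
  have hp := sum_measureReal_iteratedJoin (μ := μ) hf hξ n
  -- Termwise this is `log z ≤ z - 1` at `z = q / p`; the correction terms `q - p` have nonpositive
  -- sum.
  have key : ∀ a : Fin n → A, Real.negMulLog (μ.real (iteratedJoin f ξ n ⁻¹' {a})) ≤
      μ.real (iteratedJoin f ξ n ⁻¹' {a}) * -Real.log (Q (List.ofFn a)) +
        (Q (List.ofFn a) - μ.real (iteratedJoin f ξ n ⁻¹' {a})) := by
    intro a
    have hq := hQ (List.ofFn a) (by simp)
    rcases (measureReal_nonneg (μ := μ) (s := iteratedJoin f ξ n ⁻¹' {a})).eq_or_lt with h | h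
    · rw [← h]
      simpa using hq.le
    · set p := μ.real (iteratedJoin f ξ n ⁻¹' {a})
      have h1 := Real.log_le_sub_one_of_pos (div_pos hq h)
      rw [Real.log_div hq.ne' h.ne'] at h1
      have h2 := mul_le_mul_of_nonneg_left h1 h.le
      have h3 : p * (Q (List.ofFn a) / p - 1) = Q (List.ofFn a) - p := by field_simp
      rw [Real.negMulLog]
      linarith
  have := Finset.sum_le_sum fun a (_ : a ∈ Finset.univ) => key a
  rw [Finset.sum_add_distrib, Finset.sum_sub_distrib] at this
  linarith

end ItineraryLaw

/-! ### Masses of perturbed cylinders -/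

section Kernel

variable {A X : Type*}

/-- The probability that `w` assigns to the word `u` along the orbit of `y`. -/
def kernelWeight (f : X → X) (w : A → X → ℝ) : List A → X → ℝ
  | [], _ => 1
  | a :: u, y => w a y * kernelWeight f w u (f y)

/-- The average of `kernelWeight f w u` with respect to `μ`. -/
def kernelMass [MeasurableSpace X] (f : X → X) (w : A → X → ℝ)
    (μ : Measure X) (u : List A) : ℝ :=
  ∫ y, kernelWeight f w u y ∂μ

variable {f : X → X} {w : A → X → ℝ}

theorem kernelWeight_nonneg (hw : ∀ a y, 0 ≤ w a y) (u : List A) (y : X) :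
    0 ≤ kernelWeight f w u y := by
  induction u generalizing y with
  | nil => exact zero_le_one
  | cons a u ih => exact mul_nonneg (hw a y) (ih _)

theorem kernelWeight_le_one (hw : ∀ a y, 0 ≤ w a y) (hw1 : ∀ a y, w a y ≤ 1) (u : List A)
    (y : X) : kernelWeight f w u y ≤ 1 := by
  induction u generalizing y with
  | nil => exact le_rfl
  | cons a u ih => exact mul_le_one₀ (hw1 a y) (kernelWeight_nonneg hw _ _) (ih _)

theorem measurable_kernelWeight [MeasurableSpace X] (hf : Measurable f)
    (hw : ∀ a, Measurable (w a)) (u : List A) : Measurable (kernelWeight f w u) := by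
  induction u with
  | nil => exact measurable_const
  | cons a u ih => exact (hw a).mul (ih.comp hf)

theorem wordSum_kernelWeight_le [Fintype A] (hw : ∀ a y, 0 ≤ w a y) (hw1 : ∀ y, ∑ a, w a y ≤ 1)
    (n : ℕ) (y : X) : wordSum n (fun u => kernelWeight f w u y) ≤ 1 := by
  induction n generalizing y with
  | zero => exact le_rfl
  | succ n ih =>
    refine le_trans (Finset.sum_le_sum fun a _ => ?_) (hw1 y)
    simp only [kernelWeight]
    rw [wordSum_const_mul]
    exact mul_le_of_le_one_right (hw a y) (ih _)

theorem kernelMass_nonneg [MeasurableSpace X] (μ : Measure X) (hw : ∀ a y, 0 ≤ w a y)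
    (u : List A) : 0 ≤ kernelMass f w μ u :=
  integral_nonneg fun y => kernelWeight_nonneg hw u y

variable [MeasurableSpace X] {μ : Measure X} [IsProbabilityMeasure μ]

theorem integrable_kernelWeight (hf : Measurable f) (hwm : ∀ a, Measurable (w a))
    (hw : ∀ a y, 0 ≤ w a y) (hw1 : ∀ a y, w a y ≤ 1) (u : List A) :
    Integrable (kernelWeight f w u) μ :=
  Integrable.of_bound (measurable_kernelWeight hf hwm u).aestronglyMeasurable 1
    (Eventually.of_forall fun y => by
      rw [Real.norm_of_nonneg (kernelWeight_nonneg hw u y)]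
      exact kernelWeight_le_one hw hw1 u y)

theorem wordSum_kernelMass_le [Fintype A] (hf : Measurable f) (hwm : ∀ a, Measurable (w a))
    (hw : ∀ a y, 0 ≤ w a y) (hw1 : ∀ y, ∑ a, w a y ≤ 1) (n : ℕ) :
    wordSum n (kernelMass f w μ) ≤ 1 := by
  have hw1' : ∀ a y, w a y ≤ 1 := fun a y =>
    (Finset.single_le_sum (fun b _ => hw b y) (Finset.mem_univ a)).trans (hw1 y)
  have hi := integrable_kernelWeight (μ := μ) hf hwm hw hw1'
  rw [wordSum_eq_sum]
  simp only [kernelMass]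
  rw [← integral_finsetSum _ fun a _ => hi _]
  have h1 : ∀ y, ∑ a : Fin n → A, kernelWeight f w (List.ofFn a) y ≤ 1 := fun y => by
    rw [← wordSum_eq_sum n (fun u => kernelWeight f w u y)]
    exact wordSum_kernelWeight_le hw hw1 n y
  refine (integral_mono (integrable_finsetSum _ fun a _ => hi _) (integrable_const 1) h1).trans ?_
  simp

/-- Here `g x` bounds the cost of reading the label of `x` at a point `ε`-close to `x`. These costs
add along two orbits that stay `ε`-close, so every point of a Bowen ball gives the itinerary of its
centre a definite weight. -/
theorem exp_neg_birkhoffSum_le_kernelWeight {Y : Type*} [MetricSpace Y] {f : Y → Y}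
    {w : A → Y → ℝ} {ξ : Y → A} {g : Y → ℝ} {ε : ℝ}
    (h : ∀ x y, dist x y < ε → Real.exp (-g x) ≤ w (ξ x) y) (n : ℕ) (x y : Y)
    (hxy : ∀ i < n, dist (f^[i] x) (f^[i] y) < ε) :
    Real.exp (-birkhoffSum f g n x) ≤ kernelWeight f w (itinerary f ξ n x) y := by
  induction n generalizing x y with
  | zero => simp [itinerary, kernelWeight]
  | succ n ih =>
    rw [birkhoffSum_succ', neg_add, Real.exp_add, itinerary, kernelWeight]
    have h1 := h x y (hxy 0 n.succ_pos)
    exact mul_le_mul h1 (ih _ _ fun i hi => hxy (i + 1) (by omega)) (Real.exp_pos _).le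
      ((Real.exp_pos _).le.trans h1)

end Kernel

/-! ### Measurability of Bowen balls and of their masses; the logarithmic overhead of block lengths
-/

theorem measurable_measureReal_bowenBall {X : Type*} [MetricSpace X] [SecondCountableTopology X]
    [MeasurableSpace X] [BorelSpace X] {f : X → X} (hf : Continuous f) (μ : Measure X)
    [IsProbabilityMeasure μ] (n : ℕ) (ε : ℝ) :
    Measurable fun x => μ.real (bowenBall f x n ε) := by
  have hs : MeasurableSet {p : X × X | ∀ i ≤ n, dist (f^[i] p.1) (f^[i] p.2) < ε} := by
    have : {p : X × X | ∀ i ≤ n, dist (f^[i] p.1) (f^[i] p.2) < ε} =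
        ⋂ i, ⋂ (_ : i ≤ n), {p : X × X | dist (f^[i] p.1) (f^[i] p.2) < ε} := by
      ext; simp
    rw [this]
    refine .iInter fun i => .iInter fun _ => (isOpen_lt ?_ continuous_const).measurableSet
    exact ((hf.iterate i).comp continuous_fst).dist ((hf.iterate i).comp continuous_snd)
  exact (measurable_measure_prodMk_left hs).ennreal_toReal

theorem measurableSet_bowenBall {X : Type*} [MetricSpace X]
    [MeasurableSpace X] [BorelSpace X] {f : X → X} (hf : Continuous f) (x : X) (n : ℕ) (ε : ℝ) :
    MeasurableSet (bowenBall f x n ε) := by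
  have : bowenBall f x n ε = ⋂ i, ⋂ (_ : i ≤ n), {y | dist (f^[i] x) (f^[i] y) < ε} := by
    ext; simp [bowenBall]
  rw [this]
  exact .iInter fun i => .iInter fun _ =>
    (isOpen_lt (continuous_const.dist (hf.iterate i)) continuous_const).measurableSet

theorem eventually_log_mul_le {η : ℝ} (hη : 0 < η) :
    ∀ᶠ n : ℕ in atTop, Real.log (2 * (n * (n + 1))) ≤ n * η := by
  have h := (Real.isLittleO_log_id_atTop.comp_tendsto tendsto_natCast_atTop_atTop).bound
    (show 0 < η / 3 by positivity)
  filter_upwards [h, eventually_ge_atTop 3] with n hn hn3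
  have hn3' : (3 : ℝ) ≤ n := by exact_mod_cast hn3
  simp only [Function.comp_apply, id_eq, Real.norm_eq_abs, Nat.abs_cast] at hn
  have h1 := (le_abs_self _).trans hn
  have h2 : Real.log (2 * (n * (n + 1))) ≤ Real.log ((n : ℝ) ^ 3) := by
    refine Real.log_le_log (by positivity) ?_
    have h3 : 2 * ((n : ℝ) + 1) ≤ n ^ 2 := by nlinarith
    have h4 : (n : ℝ) * (2 * (n + 1)) ≤ n * n ^ 2 := by gcongr
    linarith
  rw [Real.log_pow] at h2
  push_cast at h2
  linarith

/-! ### Local entropies bound the entropy of partitions from above -/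

/-- Inner regularity replaces each atom by a compact subset, and disjoint compact sets have disjoint
thickenings at a common scale. This separation replaces any condition on the boundaries of the
atoms. -/
theorem exists_thickenings_of_measurable_partition {X A : Type*} [MetricSpace X] [CompleteSpace X]
    [SecondCountableTopology X] [MeasurableSpace X] [BorelSpace X] [Fintype A] [MeasurableSpace A]
    [MeasurableSingletonClass A] (μ : Measure X) [IsProbabilityMeasure μ] {ξ : X → A}
    (hξ : Measurable ξ) {η : ℝ} (hη : 0 < η) :
    ∃ K : A → Set X, (∀ a, MeasurableSet (K a)) ∧ (∀ a, K a ⊆ ξ ⁻¹' {a}) ∧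
      μ.real (⋃ a, K a)ᶜ ≤ η ∧ ∃ ε : ℝ, 0 < ε ∧
        Pairwise fun a b => Disjoint (Metric.thickening ε (K a)) (Metric.thickening ε (K b)) := by
  set β : ℝ := η / (Fintype.card A + 1) with hβ
  have hβ0 : 0 < β := by positivity
  have hK : ∀ a, ∃ K, K ⊆ ξ ⁻¹' {a} ∧ IsCompact K ∧ μ (ξ ⁻¹' {a} \ K) < ENNReal.ofReal β :=
    fun a => (hξ (MeasurableSet.singleton a)).exists_isCompact_sdiff_lt (measure_ne_top _ _)
      (by simpa using hβ0)
  choose K hKξ hKc hKμ using hK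
  refine ⟨K, fun a => (hKc a).isClosed.measurableSet, hKξ, ?_, ?_⟩
  · have hsub : (⋃ a, K a)ᶜ ⊆ ⋃ a ∈ (Finset.univ : Finset A), (ξ ⁻¹' {a} \ K a) := by
      intro x hx
      simp only [mem_compl_iff, mem_iUnion, not_exists] at hx
      simp [hx (ξ x)]
    have h1 : ∀ a, μ.real (ξ ⁻¹' {a} \ K a) ≤ β := fun a =>
      ENNReal.toReal_le_of_le_ofReal hβ0.le (hKμ a).le
    calc μ.real (⋃ a, K a)ᶜ ≤ μ.real (⋃ a ∈ (Finset.univ : Finset A), (ξ ⁻¹' {a} \ K a)) :=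
          measureReal_mono hsub (measure_ne_top _ _)
      _ ≤ ∑ a : A, μ.real (ξ ⁻¹' {a} \ K a) := measureReal_biUnion_finset_le _ _
      _ ≤ ∑ _a : A, β := Finset.sum_le_sum fun a _ => h1 a
      _ = Fintype.card A * β := by simp
      _ ≤ (Fintype.card A + 1) * β := by gcongr; linarith
      _ = η := by rw [hβ]; field_simp
  · have h : ∀ a b, a ≠ b → ∀ᶠ ε in 𝓝[>] (0 : ℝ),
        Disjoint (Metric.thickening ε (K a)) (Metric.thickening ε (K b)) := by
      intro a b hab
      have hd : Disjoint (K a) (K b) :=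
        Disjoint.mono (hKξ a) (hKξ b) (Disjoint.preimage _ (by simpa using hab))
      obtain ⟨δ, hδ, hdisj⟩ := hd.exists_thickenings (hKc a) (hKc b).isClosed
      filter_upwards [Ioo_mem_nhdsGT hδ] with r hr
      exact hdisj.mono (Metric.thickening_mono hr.2.le _) (Metric.thickening_mono hr.2.le _)
    have h' : ∀ᶠ ε in 𝓝[>] (0 : ℝ), ∀ a b, a ≠ b →
        Disjoint (Metric.thickening ε (K a)) (Metric.thickening ε (K b)) := by
      rw [eventually_all]
      intro a
      rw [eventually_all]
      intro b
      by_cases hab : a = b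
      · simp [hab]
      · simpa [hab] using h a b hab
    obtain ⟨ε, hε, hε0⟩ := (h'.and self_mem_nhdsWithin).exists
    exact ⟨ε, hε0, fun a b hab => hε a b hab⟩

section Lower

variable {X : Type*} [MetricSpace X] [CompleteSpace X] [SecondCountableTopology X]
  [MeasurableSpace X] [BorelSpace X] {f : X → X} {μ : Measure X} [IsProbabilityMeasure μ]

/-- A word of length `n` read from a point with a heavy Bowen ball costs about `n * c` in the code
built on `kernelMass`. Heavy times need only occur frequently, since the greedy cutting uses one
good time at each point. -/
theorem eventually_partitionEntropy_le_of_frequently_bowenBall {A : Type*} [Fintype A]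
    [MeasurableSpace A] [MeasurableSingletonClass A] (hf : Continuous f)
    (hμ : MeasurePreserving f μ μ) {c : ℝ} (hc : 0 ≤ c)
    (h : ∀ ε : ℝ, 0 < ε →
      ∀ᵐ x ∂μ, ∃ᶠ n : ℕ in atTop, Real.exp (-(n * c)) ≤ μ.real (bowenBall f x n ε))
    {ξ : X → A} (hξ : Measurable ξ) {η : ℝ} (hη : 0 < η) :
    ∀ᶠ N : ℕ in atTop, partitionEntropy μ (iteratedJoin f ξ N) ≤ N * (c + 4 * η) := by
  have hX : Nonempty X := nonempty_of_isProbabilityMeasure μ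
  have hA : Nonempty A := hX.map ξ
  have hk : (1 : ℝ) ≤ Fintype.card A := by exact_mod_cast Fintype.card_pos
  -- A proportion `κ` of the weight is spread uniformly over all labels. Hence a label read outside
  -- the compact sets costs at most `L`, while inside them it costs only `η`.
  set κ : ℝ := 1 - Real.exp (-η) with hκ
  have hκ0 : 0 < κ := by simpa [hκ] using hη
  have hκ1 : κ < 1 := by simp [hκ, Real.exp_pos]
  set L : ℝ := Real.log (Fintype.card A / κ) with hL
  have hL0 : 0 ≤ L := Real.log_nonneg ((one_le_div hκ0).2 (hκ1.le.trans hk))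
  have hexpL : Real.exp (-L) = κ / Fintype.card A := by
    rw [hL, ← Real.log_inv, inv_div, Real.exp_log (by positivity)]
  -- The budget `η / (L + 1)` makes the mean surcharge for reading outside the compact sets at most
  -- `η`.
  obtain ⟨K, hKm, hKξ, hKμ, ε, hε, hdisj⟩ := exists_thickenings_of_measurable_partition μ hξ
    (show 0 < η / (L + 1) by positivity)
  set w : A → X → ℝ := fun a y => κ / Fintype.card A +
    (Metric.thickening ε (K a)).indicator (fun _ => Real.exp (-η)) y with hw
  have hw0 : ∀ a y, 0 ≤ w a y := fun a y => add_nonneg (by positivity)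
    (indicator_nonneg (fun _ _ => (Real.exp_pos _).le) _)
  have hwm : ∀ a, Measurable (w a) := fun a =>
    measurable_const.add (measurable_const.indicator Metric.isOpen_thickening.measurableSet)
  have hw1 : ∀ y, ∑ a, w a y ≤ 1 := by
    intro y
    have h1 : ∑ a, (Metric.thickening ε (K a)).indicator (fun _ => Real.exp (-η)) y ≤
        Real.exp (-η) := by
      by_cases hy : ∃ a, y ∈ Metric.thickening ε (K a)
      · obtain ⟨a, ha⟩ := hy
        rw [Finset.sum_eq_single a]
        · exact indicator_le_self' (fun _ _ => (Real.exp_pos _).le) _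
        · intro b _ hb
          exact indicator_of_notMem (fun hyb => (hdisj hb).le_bot ⟨hyb, ha⟩) _
        · simp
      · push Not at hy
        rw [Finset.sum_eq_zero fun a _ => indicator_of_notMem (hy a) _]
        exact (Real.exp_pos _).le
    rw [Finset.sum_add_distrib, Finset.sum_const, Finset.card_univ, nsmul_eq_mul,
      mul_div_cancel₀ _ (by positivity)]
    linarith
  set g : X → ℝ := fun x => η + (⋃ a, K a)ᶜ.indicator (fun _ => L) x with hg
  have hKm' : MeasurableSet (⋃ a, K a)ᶜ := (MeasurableSet.iUnion hKm).compl
  have hgw : ∀ x y, dist x y < ε → Real.exp (-g x) ≤ w (ξ x) y := by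
    intro x y hxy
    by_cases hx : x ∈ ⋃ a, K a
    · obtain ⟨a, ha⟩ := mem_iUnion.1 hx
      obtain rfl : ξ x = a := hKξ a ha
      have hy : y ∈ Metric.thickening ε (K (ξ x)) :=
        Metric.mem_thickening_iff.2 ⟨x, ha, by rwa [dist_comm]⟩
      have : g x = η := by simp only [hg]; rw [indicator_of_notMem (by simpa using hx), add_zero]
      rw [this, hw]
      simp only
      rw [indicator_of_mem hy]
      have : 0 ≤ κ / Fintype.card A := by positivity
      linarith
    · have : g x = η + L := by simp only [hg]; rw [indicator_of_mem (by simpa using hx)]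
      have h2 : 0 ≤ (Metric.thickening ε (K (ξ x))).indicator (fun _ => Real.exp (-η)) y :=
        indicator_nonneg (fun _ _ => (Real.exp_pos _).le) _
      have h3 : Real.exp (-g x) ≤ Real.exp (-L) := Real.exp_le_exp.2 (by linarith)
      rw [hexpL] at h3
      simp only [hw]
      linarith
  set R : List A → ℝ := kernelMass f w μ with hR
  have hfm : Measurable f := hf.measurable
  have hR0 : ∀ u, 0 ≤ R u := kernelMass_nonneg μ hw0
  have hR1 : ∀ n, wordSum n R ≤ 1 := wordSum_kernelMass_le hfm hwm hw0 hw1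
  have hw1' : ∀ a y, w a y ≤ 1 := fun a y =>
    (Finset.single_le_sum (fun b _ => hw0 b y) (Finset.mem_univ a)).trans (hw1 y)
  have hRlow : ∀ n x, Real.exp (-birkhoffSum f g n x) * μ.real (bowenBall f x n ε) ≤
      R (itinerary f ξ n x) := by
    intro n x
    have hBm := measurableSet_bowenBall hf x n ε
    have hind : (bowenBall f x n ε).indicator (fun _ => Real.exp (-birkhoffSum f g n x)) ≤
        kernelWeight f w (itinerary f ξ n x) := by
      refine indicator_le' (fun y hy => ?_) (fun y _ => kernelWeight_nonneg hw0 _ _)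
      exact exp_neg_birkhoffSum_le_kernelWeight hgw n x y fun i hi => hy i hi.le
    have := integral_mono ((integrable_const _).indicator hBm)
      (integrable_kernelWeight (μ := μ) hfm hwm hw0 hw1' _) hind
    rw [integral_indicator_const _ hBm, smul_eq_mul, mul_comm] at this
    exact this
  obtain ⟨n0, hn0⟩ := eventually_atTop.1 (eventually_log_mul_le hη)
  set G : X → ℝ := fun x => (c + η) + g x with hG
  have hgint : Integrable g μ :=
    (integrable_const η).add ((integrable_const L).indicator hKm')
  have hGint : Integrable G μ := (integrable_const _).add hgint
  have hg0 : ∀ x, 0 ≤ g x := fun x =>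
    add_nonneg hη.le (indicator_nonneg (fun _ _ => hL0) _)
  have hgI : ∫ x, g x ∂μ ≤ 2 * η := by
    simp only [hg]
    rw [integral_add (integrable_const η) ((integrable_const L).indicator hKm'),
      integral_indicator_const _ hKm']
    have h1 : μ.real (⋃ a, K a)ᶜ * L ≤ η / (L + 1) * (L + 1) := by gcongr; linarith
    rw [div_mul_cancel₀ _ (by positivity)] at h1
    simp only [integral_const, probReal_univ, smul_eq_mul]
    linarith
  have hGI : ∫ x, G x ∂μ ≤ c + 3 * η := by
    simp only [hG]
    rw [integral_add (integrable_const _) hgint]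
    simp only [integral_const, probReal_univ, one_smul]
    linarith
  have key := eventually_integral_le_of_greedy hμ (θ := codeCost R f ξ)
    (fun N => integrable_comp_itinerary hfm hξ N (fun u => -Real.log (mixCode R N u)))
    hGint (C := Real.log (2 * Fintype.card A)) (Real.log_nonneg (by linarith))
    (P := fun n x => (1 ≤ n ∧ n0 ≤ n) ∧ Real.exp (-(n * c)) ≤ μ.real (bowenBall f x n ε))
    (fun n => (MeasurableSet.const _).inter
      (measurableSet_le measurable_const (measurable_measureReal_bowenBall hf μ n ε)))
    (by
      filter_upwards [h ε hε] with x hx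
      obtain ⟨n, hn, hn'⟩ := (hx.and_eventually
        ((eventually_ge_atTop 1).and (eventually_ge_atTop n0))).exists
      exact ⟨n, hn', hn⟩)
    (fun x => (codeCost_zero R f ξ x).le)
    (fun N x => by
      have := codeCost_succ_le hR0 f ξ N x
      have := hg0 x
      simp only [hG]
      linarith)
    (fun n x ⟨⟨hn1, hnn0⟩, hx⟩ => ⟨hn1, fun N => by
      have h1 : Real.exp (-birkhoffSum f g n x + -(n * c)) ≤ R (itinerary f ξ n x) := by
        rw [Real.exp_add]
        exact (mul_le_mul_of_nonneg_left hx (Real.exp_pos _).le).trans (hRlow n x)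
      have h2 := (Real.exp_pos _).trans_le h1
      have h3 := (Real.le_log_iff_exp_le h2).2 h1
      have h4 := codeCost_add_le hR0 f ξ hn1 N x h2
      have h5 := hn0 n hnn0
      have h6 : birkhoffSum f G n x = n * (c + η) + birkhoffSum f g n x := by
        simp [hG, birkhoffSum, Finset.sum_add_distrib, mul_add]
      rw [h6]
      linarith⟩) hη
  filter_upwards [key] with N hN
  have h1 := partitionEntropy_le_integral (μ := μ) hfm hξ N (Q := mixCode R N)
    (fun u hu => hu ▸ mixCode_pos hR0 u) (wordSum_mixCode_le hR0 hR1 N)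
  refine (h1.trans hN).trans (mul_le_mul_of_nonneg_left ?_ N.cast_nonneg)
  linarith

theorem metricEntropy_le_of_frequently_bowenBall (hf : Continuous f)
    (hμ : MeasurePreserving f μ μ) {c : ℝ} (hc : 0 ≤ c)
    (h : ∀ ε : ℝ, 0 < ε →
      ∀ᵐ x ∂μ, ∃ᶠ n : ℕ in atTop, Real.exp (-(n * c)) ≤ μ.real (bowenBall f x n ε)) :
    metricEntropy f μ ≤ c := by
  refine iSup_le fun k => iSup₂_le fun ξ hξ => ?_
  refine EReal.le_of_forall_lt_iff_le.1 fun z hz => ?_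
  have hz' : c < z := by exact_mod_cast hz
  refine limsup_le_of_le (by isBoundedDefault) ?_
  filter_upwards [eventually_partitionEntropy_le_of_frequently_bowenBall hf hμ hc h hξ
    (show 0 < (z - c) / 4 by linarith), eventually_ge_atTop 1] with N hN hN1
  have hN0 : (0 : ℝ) < N := by exact_mod_cast hN1
  rw [EReal.coe_le_coe_iff, div_le_iff₀ hN0]
  linarith

/-- If the bound failed at every scale, heavy Bowen balls would occur frequently on a set of
positive measure. Ergodicity makes this full measure, and the preceding bound then gives `h_μ(f) ≤
c'` for some `c' < h_μ(f)`. -/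
theorem exists_ae_eventually_bowenBall_le (hf : Continuous f) (hμ : Ergodic f μ) {c : ℝ}
    (hc : 0 ≤ c) (h : (c : EReal) < metricEntropy f μ) : ∃ ε : ℝ, 0 < ε ∧
      ∀ᵐ x ∂μ, ∀ᶠ n : ℕ in atTop, μ.real (bowenBall f x n ε) ≤ Real.exp (-(n * c)) := by
  obtain ⟨c', hcc', hc'⟩ := EReal.lt_iff_exists_real_btwn.1 h
  have hcc : c < c' := by exact_mod_cast hcc'
  by_contra! hcon
  refine hc'.not_ge (metricEntropy_le_of_frequently_bowenBall hf hμ.toMeasurePreserving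
    (hc.trans hcc.le) fun ε hε => ?_)
  -- The free constant `C` makes `E ⊆ f ⁻¹' E`, since passing from `x` to `f x` shortens the Bowen
  -- ball by one time and costs a factor `exp c`. The constant is absorbed later by the gap `c' -
  -- c`.
  set E : Set X := {x | ∃ C : ℕ, ∃ᶠ n : ℕ in atTop,
    Real.exp (-(n * c)) < C * μ.real (bowenBall f x n ε)} with hE
  have hEm : MeasurableSet E := by
    have : E = ⋃ C : ℕ, ⋂ a : ℕ, ⋃ b : ℕ, ⋃ (_ : a ≤ b),
        {x | Real.exp (-(b * c)) < C * μ.real (bowenBall f x b ε)} := by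
      ext x
      simp [hE, frequently_atTop]
    rw [this]
    exact .iUnion fun m => .iInter fun a => .iUnion fun b => .iUnion fun _ =>
      measurableSet_lt measurable_const
        ((measurable_measureReal_bowenBall hf μ b ε).const_mul _)
  have hstep : ∀ n x, μ.real (bowenBall f x (n + 1) ε) ≤ μ.real (bowenBall f (f x) n ε) := by
    intro n x
    rw [← hμ.toMeasurePreserving.measureReal_preimage
      (measurableSet_bowenBall hf (f x) n ε).nullMeasurableSet]
    exact measureReal_mono fun y hy i hi => hy (i + 1) (by omega)
  have hEinv : E ⊆ f ⁻¹' E := by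
    rintro x ⟨C, hC⟩
    refine ⟨⌈C * Real.exp c⌉₊, ?_⟩
    rw [frequently_atTop] at hC ⊢
    intro a
    obtain ⟨b, hb, hbx⟩ := hC (a + 1)
    obtain ⟨n, rfl⟩ : ∃ n, b = n + 1 := ⟨b - 1, by omega⟩
    refine ⟨n, by omega, ?_⟩
    calc Real.exp (-(n * c)) = Real.exp c * Real.exp (-((n + 1 : ℕ) * c)) := by
          rw [← Real.exp_add]; congr 1; push_cast; ring
      _ < Real.exp c * (C * μ.real (bowenBall f x (n + 1) ε)) := by gcongr
      _ ≤ Real.exp c * (C * μ.real (bowenBall f (f x) n ε)) := 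
          mul_le_mul_of_nonneg_left (mul_le_mul_of_nonneg_left (hstep n x) C.cast_nonneg)
            (Real.exp_pos c).le
      _ = C * Real.exp c * μ.real (bowenBall f (f x) n ε) := by ring
      _ ≤ ⌈C * Real.exp c⌉₊ * μ.real (bowenBall f (f x) n ε) := by
          gcongr; exact Nat.le_ceil _
  have hnot : ¬ E =ᵐ[μ] (∅ : Set X) := by
    rw [eventuallyEq_empty]
    intro hnull
    refine hcon ε hε ?_
    filter_upwards [hnull] with x hx
    simp only [hE, mem_ofPred_eq, not_exists, not_frequently, not_lt] at hx
    rw [not_frequently]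
    filter_upwards [hx 1] with n hn
    simpa using hn
  have huniv := (hμ.ae_empty_or_univ_of_ae_le_preimage hEm.nullMeasurableSet
    (Eventually.of_forall hEinv)).resolve_left hnot
  rw [eventuallyEq_univ] at huniv
  filter_upwards [huniv] with x ⟨C, hC⟩
  obtain ⟨n0, hn0⟩ := exists_nat_gt (Real.log (C + 1) / (c' - c))
  refine (hC.and_eventually (eventually_ge_atTop n0)).mono fun n ⟨hn, hn0n⟩ => ?_
  have h1 : Real.log (C + 1) ≤ n * (c' - c) := by
    rw [div_lt_iff₀ (sub_pos.2 hcc)] at hn0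
    have : (n0 : ℝ) * (c' - c) ≤ n * (c' - c) := by
      have := sub_pos.2 hcc
      gcongr
    linarith
  have hC1 : (0 : ℝ) < C + 1 := by positivity
  have h2 : (C : ℝ) + 1 ≤ Real.exp (n * (c' - c)) := (Real.log_le_iff_le_exp hC1).1 h1
  have h3 : Real.exp (-(n * c')) * Real.exp (n * (c' - c)) = Real.exp (-(n * c)) := by
    rw [← Real.exp_add]; congr 1; ring
  have h4 : (0 : ℝ) ≤ μ.real (bowenBall f x n ε) := measureReal_nonneg
  have h5 : Real.exp (-(n * c')) * (C + 1) ≤ (C + 1) * μ.real (bowenBall f x n ε) := by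
    have := mul_le_mul_of_nonneg_left h2 (Real.exp_pos (-(n * c'))).le
    rw [h3] at this
    linarith
  rw [mul_comm] at h5
  exact le_of_mul_le_mul_left h5 hC1

end Lower

/-! ### The upper half of the Shannon–McMillan–Breiman theorem -/

section Upper

variable {X A : Type*} [MeasurableSpace X] [Fintype A] [MeasurableSpace A]
  [MeasurableSingletonClass A] {f : X → X} {μ : Measure X} [IsProbabilityMeasure μ] {ξ : X → A}

/-- The measure of the cylinder of the word `u`. -/
def cylinderMass {X A : Type*} [MeasurableSpace X] (f : X → X) (ξ : X → A) (μ : Measure X)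
    (u : List A) : ℝ :=
  μ.real {y | itinerary f ξ u.length y = u}

theorem cylinderMass_nonneg {X A : Type*} [MeasurableSpace X] (f : X → X) (ξ : X → A)
    (μ : Measure X) (u : List A) : 0 ≤ cylinderMass f ξ μ u :=
  measureReal_nonneg

theorem cylinderMass_ofFn {X A : Type*} [MeasurableSpace X] (f : X → X) (ξ : X → A)
    (μ : Measure X) {n : ℕ} (a : Fin n → A) :
    cylinderMass f ξ μ (List.ofFn a) = μ.real (iteratedJoin f ξ n ⁻¹' {a}) := by
  unfold cylinderMass
  congr 1
  ext y
  simp [itinerary_eq_ofFn]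

theorem wordSum_cylinderMass (hf : Measurable f) (hξ : Measurable ξ) (n : ℕ) :
    wordSum n (cylinderMass f ξ μ) = 1 := by
  rw [wordSum_eq_sum, ← sum_measureReal_iteratedJoin (μ := μ) hf hξ n]
  exact Finset.sum_congr rfl fun a _ => cylinderMass_ofFn f ξ μ a

/-- The cylinders lighter than `mixCode / (n + 1) ^ 2` have total mass at most `1 / (n + 1) ^ 2`,
because the code is a sub-probability. This is summable, so Borel–Cantelli applies. -/
theorem ae_eventually_mixCode_le_cylinderMass [Nonempty A] (hf : Measurable f) (hξ : Measurable ξ)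
    {R : List A → ℝ} (hR0 : ∀ u, 0 ≤ R u) (hR : ∀ n, wordSum n R ≤ 1) :
    ∀ᵐ x ∂μ, ∀ᶠ n : ℕ in atTop, mixCode R n (itinerary f ξ n x) / (n + 1) ^ 2 ≤
      cylinderMass f ξ μ (itinerary f ξ n x) := by
  set B : ℕ → Set X := fun n => {x | cylinderMass f ξ μ (itinerary f ξ n x) <
    mixCode R n (itinerary f ξ n x) / (n + 1) ^ 2} with hB
  have hBm : ∀ n, MeasurableSet (B n) := fun n => measurableSet_lt
    (measurable_comp_itinerary hf hξ n (cylinderMass f ξ μ))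
    (measurable_comp_itinerary hf hξ n (fun u => mixCode R n u / (n + 1) ^ 2))
  have hBμ : ∀ n, μ (B n) ≤ ENNReal.ofReal (1 / ((n + 1 : ℕ) : ℝ) ^ 2) := by
    intro n
    refine (ENNReal.le_ofReal_iff_toReal_le (measure_ne_top _ _) (by positivity)).2 ?_
    have h1 : μ.real (B n) = ∫ x, (fun u => if cylinderMass f ξ μ u <
        mixCode R n u / (n + 1) ^ 2 then (1 : ℝ) else 0) (itinerary f ξ n x) ∂μ := by
      rw [← integral_indicator_one (hBm n)]
      refine integral_congr_ae (Eventually.of_forall fun x => ?_)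
      simp only [indicator_apply, hB, mem_ofPred_eq, Pi.one_apply]
    change μ.real (B n) ≤ _
    refine (h1.trans (integral_comp_itinerary hf hξ n (fun u => if cylinderMass f ξ μ u <
        mixCode R n u / (n + 1) ^ 2 then (1 : ℝ) else 0))).le.trans ?_
    have h2 : ∀ a : Fin n → A, μ.real (iteratedJoin f ξ n ⁻¹' {a}) *
        (if cylinderMass f ξ μ (List.ofFn a) <
          mixCode R n (List.ofFn a) / (n + 1) ^ 2 then (1 : ℝ) else 0) ≤
        mixCode R n (List.ofFn a) / (n + 1) ^ 2 := by
      intro a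
      rw [← cylinderMass_ofFn]
      split_ifs with h
      · rw [mul_one]
        exact h.le
      · rw [mul_zero]
        have := mixCode_nonneg hR0 n (List.ofFn a)
        positivity
    refine (Finset.sum_le_sum fun a _ => h2 a).trans ?_
    rw [← Finset.sum_div, ← wordSum_eq_sum n (mixCode R n)]
    push_cast
    gcongr
    exact wordSum_mixCode_le hR0 hR n
  have hsum : Summable fun n : ℕ => 1 / ((n + 1 : ℕ) : ℝ) ^ 2 :=
    (summable_nat_add_iff 1).2 (Real.summable_one_div_nat_pow.2 one_lt_two)
  have := ae_eventually_notMem (μ := μ) (s := B)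
    (ne_top_of_le_ne_top hsum.tsum_ofReal_ne_top (ENNReal.tsum_le_tsum hBμ))
  filter_upwards [this] with x hx
  filter_upwards [hx] with n hn
  simpa [hB] using hn

/-- Upper half of Shannon–McMillan–Breiman: coding by `m`-blocks with their own law has mean cost
per symbol close to `H_m / m`, and the pointwise ergodic theorem makes this an almost sure bound on
the code length. -/
theorem ae_eventually_exp_le_cylinderMass (hf : Ergodic f μ) (hξ : Measurable ξ) {t : ℝ}
    (ht : entropyOfPartition f μ ξ < t) :
    ∀ᵐ x ∂μ, ∀ᶠ n : ℕ in atTop,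
      Real.exp (-(n * t)) ≤ cylinderMass f ξ μ (itinerary f ξ n x) := by
  have hX : Nonempty X := nonempty_of_isProbabilityMeasure μ
  have hA : Nonempty A := hX.map ξ
  have hfm := hf.measurable
  have hk : (1 : ℝ) ≤ Fintype.card A := by exact_mod_cast Fintype.card_pos
  obtain ⟨t₀, ht₀, ht₀t⟩ := EReal.lt_iff_exists_real_btwn.1 ht
  have htt : t₀ < t := by exact_mod_cast ht₀t
  -- Three of the four parts are spent: on the block-length overhead, on the boundary term `2 * m *
  -- C`, and on the factor `(n + 1) ^ 2` from Borel–Cantelli.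
  set η : ℝ := (t - t₀) / 4 with hη
  have hη0 : 0 < η := by rw [hη]; linarith
  obtain ⟨m, hmH, hmlog, hm⟩ := ((eventually_lt_of_limsup_lt ht₀).and
    ((eventually_log_mul_le hη0).and (eventually_ge_atTop 1))).exists
  have hm0 : (1 : ℝ) ≤ m := by exact_mod_cast hm
  rw [EReal.coe_lt_coe_iff, div_lt_iff₀ (by positivity)] at hmH
  set R := cylinderMass f ξ μ with hR
  have hR0 : ∀ u, 0 ≤ R u := cylinderMass_nonneg f ξ μ
  have hR1 : ∀ n, wordSum n R ≤ 1 := fun n => (wordSum_cylinderMass hfm hξ n).le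
  set C : ℝ := Real.log (2 * Fintype.card A) with hC
  have hC0 : 0 ≤ C := Real.log_nonneg (by linarith)
  -- Words of zero mass are coded letter by letter, at cost `m * C`. The block estimate thus holds
  -- at every point, and these words do not contribute to the integral.
  set F : List A → ℝ := fun u => if 0 < R u then
    Real.log (2 * (m * (m + 1))) - Real.log (R u) else m * C with hF
  set g : X → ℝ := fun x => F (itinerary f ξ m x) with hg
  have hlogm : 0 ≤ Real.log (2 * (m * (m + 1))) := Real.log_nonneg (by nlinarith)
  have hg0 : ∀ x, 0 ≤ g x := by
    intro x
    simp only [hg, hF]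
    split_ifs
    · have := Real.log_nonpos (hR0 (itinerary f ξ m x)) measureReal_le_one
      linarith
    · positivity
  have hstep := codeCost_succ_le hR0 f ξ
  have hstep' : ∀ j N x, codeCost R f ξ (N + j) x ≤ j * C + codeCost R f ξ N (f^[j] x) := by
    intro j
    induction j with
    | zero => intro N x; simp
    | succ j ih =>
      intro N x
      have h1 := hstep (N + j) x
      have h2 := ih N (f x)
      rw [Function.iterate_succ_apply, ← add_assoc]
      push_cast
      linarith
  have hblock : ∀ N x, codeCost R f ξ (N + m) x ≤ g x + codeCost R f ξ N (f^[m] x) := by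
    intro N x
    simp only [hg, hF]
    split_ifs with h
    · exact codeCost_add_le hR0 f ξ hm N x h
    · exact hstep' m N x
  have hgI : ∫ x, g x ∂μ < m * (t₀ + η) := by
    have h1 : ∫ x, g x ∂μ = Real.log (2 * (m * (m + 1))) +
        partitionEntropy μ (iteratedJoin f ξ m) := by
      simp only [hg]
      rw [integral_comp_itinerary hfm hξ, partitionEntropy]
      have h2 : Real.log (2 * (m * (m + 1))) = ∑ a : Fin m → A,
          μ.real (iteratedJoin f ξ m ⁻¹' {a}) * Real.log (2 * (m * (m + 1))) := by
        rw [← Finset.sum_mul, sum_measureReal_iteratedJoin hfm hξ, one_mul]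
      rw [h2, ← Finset.sum_add_distrib]
      refine Finset.sum_congr rfl fun a _ => ?_
      simp only [hF, hR]
      rw [cylinderMass_ofFn]
      split_ifs with h
      · rw [Real.negMulLog]
        ring
      · rw [le_antisymm (not_lt.1 h) measureReal_nonneg]
        simp
    rw [h1]
    linarith
  obtain ⟨B, hB⟩ := exists_abs_comp_itinerary_le f ξ m F
  have hmain := mul_le_birkhoffSum_of_blocks (θ := codeCost R f ξ) hC0 hg0 hm
    (fun x => (codeCost_zero R f ξ x).le) hstep hblock
  obtain ⟨n₁, hn₁⟩ := exists_nat_gt (2 * m * C / η)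
  filter_upwards [ae_eventually_birkhoffSum_le hf (measurable_comp_itinerary hfm hξ m F) hB hgI,
    ae_eventually_mixCode_le_cylinderMass (μ := μ) hfm hξ hR0 hR1] with x hx1 hx2
  filter_upwards [hx1, hx2, eventually_log_mul_le hη0, eventually_ge_atTop n₁,
    eventually_ge_atTop 1] with n h1 h2 h3 h4 h5
  have hn1 : (1 : ℝ) ≤ n := by exact_mod_cast h5
  have h6 : codeCost R f ξ n x ≤ n * (t₀ + η) + 2 * m * C := by
    have h7 := (hmain n x).trans (add_le_add_left h1 _)
    have h8 : (m : ℝ) * codeCost R f ξ n x ≤ m * (n * (t₀ + η) + 2 * m * C) := by linarith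
    exact le_of_mul_le_mul_left h8 (by positivity)
  have h7 : 2 * m * C ≤ n * η := by
    rw [div_lt_iff₀ hη0] at hn₁
    have : (n₁ : ℝ) * η ≤ n * η := by gcongr
    linarith
  have hQ := mixCode_itinerary_pos hR0 f ξ n x
  have h8 : Real.log ((n + 1 : ℝ) ^ 2) ≤ n * η := by
    refine le_trans (Real.log_le_log (by positivity) ?_) h3
    nlinarith
  refine le_trans ?_ h2
  rw [← Real.le_log_iff_exp_le (by positivity), Real.log_div hQ.ne' (by positivity)]
  have h9 : codeCost R f ξ n x = -Real.log (mixCode R n (itinerary f ξ n x)) := rfl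
  have h10 : (n : ℝ) * t = n * (t₀ + η) + 3 * (n * η) := by rw [hη]; ring
  have h11 : (0 : ℝ) ≤ n * η := by positivity
  linarith

end Upper

/-! ### From cylinders to Bowen balls on compact spaces -/

open TopologicalSpace in
-- Label each point by its nearest member of a finite `ε / 2`-net; points with the same label are
-- within `ε` by the triangle inequality.
theorem exists_measurable_labelling {X : Type*} [MetricSpace X] [CompactSpace X] [Nonempty X]
    [MeasurableSpace X] [BorelSpace X] {ε : ℝ} (hε : 0 < ε) :
    ∃ (k : ℕ) (ξ : X → Fin k), Measurable ξ ∧ ∀ x y, ξ x = ξ y → dist x y < ε := by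
  have hU : (univ : Set X) ⊆ ⋃ n : ℕ, Metric.ball (denseSeq X n) (ε / 2) := by
    intro x _
    obtain ⟨y, hn, n, rfl⟩ := Metric.dense_iff.1 (denseRange_denseSeq X) x (ε / 2) (half_pos hε)
    exact mem_iUnion.2 ⟨n, by simpa [dist_comm] using hn⟩
  obtain ⟨t, ht⟩ := isCompact_univ.elim_finite_subcover _ (fun _ => Metric.isOpen_ball) hU
  set N := t.sup id
  have hlt : ∀ x, SimpleFunc.nearestPtInd (denseSeq X) N x < N + 1 := fun x =>
    Nat.lt_succ_of_le (SimpleFunc.nearestPtInd_le _ _ _)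
  have hclose : ∀ x,
      dist (denseSeq X (SimpleFunc.nearestPtInd (denseSeq X) N x)) x < ε / 2 := by
    intro x
    obtain ⟨n, hnt, hn⟩ := mem_iUnion₂.1 (ht (mem_univ x))
    have h1 := SimpleFunc.edist_nearestPt_le (denseSeq X) x (Finset.le_sup (f := id) hnt)
    rw [edist_dist, edist_dist, ENNReal.ofReal_le_ofReal_iff dist_nonneg] at h1
    exact h1.trans_lt (by rw [dist_comm]; exact hn)
  refine ⟨N + 1, fun x => ⟨_, hlt x⟩, ?_, fun x y hxy => ?_⟩
  · refine measurable_to_countable' fun i => ?_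
    convert (SimpleFunc.nearestPtInd (denseSeq X) N).measurableSet_fiber i using 1
    ext x
    simp [Fin.ext_iff]
  · have hxy' : SimpleFunc.nearestPtInd (denseSeq X) N x =
        SimpleFunc.nearestPtInd (denseSeq X) N y := by simpa using hxy
    have h1 := hclose x
    have h2 := hclose y
    rw [← hxy'] at h2
    have := dist_triangle_left x y (denseSeq X (SimpleFunc.nearestPtInd (denseSeq X) N x))
    linarith

theorem dist_iterate_lt_of_itinerary_eq {X A : Type*} [MetricSpace X] {f : X → X} {ξ : X → A}
    {ε : ℝ} (hξ : ∀ x y, ξ x = ξ y → dist x y < ε) {n : ℕ} {x y : X}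
    (h : itinerary f ξ n x = itinerary f ξ n y) : ∀ i < n, dist (f^[i] x) (f^[i] y) < ε := by
  rw [itinerary_eq_ofFn, itinerary_eq_ofFn, List.ofFn_inj] at h
  exact fun i hi => hξ _ _ (congrFun h ⟨i, hi⟩)

theorem ae_eventually_exp_le_bowenBall {X : Type*} [MetricSpace X] [CompactSpace X]
    [MeasurableSpace X] [BorelSpace X] {f : X → X} {μ : Measure X} [IsProbabilityMeasure μ]
    (hf : Ergodic f μ) {t : ℝ} (ht : metricEntropy f μ < t) {ε : ℝ} (hε : 0 < ε) :
    ∀ᵐ x ∂μ, ∀ᶠ n : ℕ in atTop, Real.exp (-(n * t)) ≤ μ.real (bowenBall f x n ε) := by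
  have hX : Nonempty X := nonempty_of_isProbabilityMeasure μ
  obtain ⟨t', htt, ht'⟩ := EReal.lt_iff_exists_real_btwn.1 ht
  have ht't : t' < t := by exact_mod_cast ht'
  obtain ⟨k, ξ, hξ, hd⟩ := exists_measurable_labelling (X := X) hε
  have hle : entropyOfPartition f μ ξ ≤ metricEntropy f μ :=
    le_iSup_of_le k (le_iSup₂_of_le ξ hξ le_rfl)
  obtain ⟨n₀, hn₀⟩ := exists_nat_gt (t' / (t - t'))
  rw [div_lt_iff₀ (sub_pos.2 ht't)] at hn₀
  filter_upwards [ae_eventually_exp_le_cylinderMass hf hξ (hle.trans_lt htt)] with x hx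
  -- A Bowen ball of size `n` involves the `n + 1` times `0, …, n`, so cylinders of length `n + 1`
  -- are used; the extra `t'` is absorbed by `n * (t - t')`.
  filter_upwards [(tendsto_add_atTop_nat 1).eventually hx, eventually_ge_atTop n₀] with n hn hn0
  have h1 : (n₀ : ℝ) * (t - t') ≤ n * (t - t') := by
    have := sub_pos.2 ht't
    gcongr
  calc Real.exp (-(n * t)) ≤ Real.exp (-((n + 1 : ℕ) * t')) := by
        refine Real.exp_le_exp.2 ?_
        push_cast
        linarith
    _ ≤ _ := hn
    _ ≤ μ.real (bowenBall f x n ε) := by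
        refine measureReal_mono fun y hy i hi => ?_
        simp only [length_itinerary, mem_ofPred_eq] at hy
        exact dist_iterate_lt_of_itinerary_eq hd hy.symm i (by omega)

/-! ### Comparison of balls and Bowen balls -/

section Comparison

variable {X : Type*} [MetricSpace X] {f : X → X}

theorem ball_subset_bowenBall {Λ δ : ℝ} (hΛ : 1 < Λ)
    (h : ∀ x y : X, dist x y < δ → dist (f x) (f y) ≤ Λ * dist x y) {ε : ℝ} (hεδ : ε ≤ δ)
    {x : X} {n : ℕ} {r : ℝ} (hr : Λ ^ n * r ≤ ε) : Metric.ball x r ⊆ bowenBall f x n ε := by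
  intro y hy
  have hd : dist x y < r := by rw [dist_comm]; exact hy
  have key : ∀ i ≤ n, dist (f^[i] x) (f^[i] y) ≤ Λ ^ i * dist x y ∧ Λ ^ i * dist x y < ε := by
    have hlt : ∀ i ≤ n, Λ ^ i * dist x y < ε := fun i hi => by
      refine lt_of_lt_of_le ?_ hr
      calc Λ ^ i * dist x y ≤ Λ ^ n * dist x y := by gcongr; exact hΛ.le
        _ < Λ ^ n * r := by gcongr
    intro i
    induction i with
    | zero => intro hi; exact ⟨by simp, hlt 0 hi⟩
    | succ i ih =>
      intro hi
      obtain ⟨h1, h2⟩ := ih (by omega)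
      refine ⟨?_, hlt _ hi⟩
      rw [Function.iterate_succ_apply', Function.iterate_succ_apply', pow_succ']
      calc dist (f (f^[i] x)) (f (f^[i] y)) ≤ Λ * dist (f^[i] x) (f^[i] y) :=
            h _ _ (h1.trans_lt (h2.trans_le hεδ))
        _ ≤ Λ * (Λ ^ i * dist x y) := by gcongr
        _ = Λ * Λ ^ i * dist x y := by ring
  exact fun i hi => (key i hi).1.trans_lt (key i hi).2

theorem bowenBall_subset_ball {lam δ : ℝ} (hlam : 1 < lam)
    (h : ∀ x y : X, dist x y < δ → lam * dist x y ≤ dist (f x) (f y)) {ε : ℝ} (hεδ : ε ≤ δ)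
    {x : X} {n : ℕ} {r : ℝ} (hr : ε ≤ lam ^ n * r) : bowenBall f x n ε ⊆ Metric.ball x r := by
  intro y hy
  have key : ∀ i ≤ n, lam ^ i * dist x y ≤ dist (f^[i] x) (f^[i] y) := by
    intro i
    induction i with
    | zero => simp
    | succ i ih =>
      intro hi
      rw [Function.iterate_succ_apply', Function.iterate_succ_apply', pow_succ']
      calc lam * lam ^ i * dist x y = lam * (lam ^ i * dist x y) := by ring
        _ ≤ lam * dist (f^[i] x) (f^[i] y) := by gcongr; exact ih (by omega)
        _ ≤ _ := h _ _ ((hy i (by omega)).trans_le hεδ)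
  have h1 : lam ^ n * dist x y < lam ^ n * r := ((key n le_rfl).trans_lt (hy n le_rfl)).trans_le hr
  rw [Metric.mem_ball, dist_comm]
  exact lt_of_mul_lt_mul_left h1 (by positivity)

theorem eventually_lt_neg_log (a : ℝ) : ∀ᶠ r in 𝓝[>] (0 : ℝ), a < -Real.log r := by
  filter_upwards [Real.tendsto_log_nhdsGT_zero.eventually (eventually_lt_atBot (-a))] with r hr
  linarith

variable [MeasurableSpace X] {μ : Measure X} [IsProbabilityMeasure μ]

theorem eventually_ball_le_of_bowenBall_le {Λ δ : ℝ} (hΛ : 1 < Λ)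
    (h : ∀ x y : X, dist x y < δ → dist (f x) (f y) ≤ Λ * dist x y) {ε : ℝ} (hε : 0 < ε)
    (hεδ : ε ≤ δ) {x : X} {θ s : ℝ} (hθ : 0 ≤ θ) (hs : s < θ / Real.log Λ)
    (hB : ∀ᶠ n : ℕ in atTop, μ.real (bowenBall f x n ε) ≤ Real.exp (-(n * θ))) :
    ∀ᶠ r in 𝓝[>] (0 : ℝ), μ.real (Metric.ball x r) ≤ r ^ s := by
  set L := Real.log Λ with hL
  have hL0 : 0 < L := Real.log_pos hΛ
  obtain ⟨n₀, hn₀⟩ := eventually_atTop.1 hB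
  -- The first threshold on `-log r` ensures `n₀ ≤ n`. The second is the condition under which the
  -- gap `θ / L - s` pays for `ε` and for rounding `u` down to an integer.
  filter_upwards [self_mem_nhdsWithin, eventually_lt_neg_log (L * (n₀ + 1) - Real.log ε),
    eventually_lt_neg_log ((θ - θ / L * Real.log ε) / (θ / L - s))] with r hr h1 h2
  have hr0 : (0 : ℝ) < r := hr
  set u : ℝ := (Real.log ε - Real.log r) / L with hu
  have hun : (n₀ : ℝ) + 1 ≤ u := by
    rw [hu, le_div_iff₀ hL0]
    linarith
  have hu0 : 0 ≤ u := le_trans (by positivity) hun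
  set n : ℕ := ⌊u⌋₊ with hn
  have hnu : (n : ℝ) ≤ u := Nat.floor_le hu0
  have hun' : u < n + 1 := Nat.lt_floor_add_one u
  have hnn : n₀ ≤ n := by
    have : (n₀ : ℝ) < n + 1 := by linarith
    exact_mod_cast Nat.lt_succ_iff.1 (by exact_mod_cast this)
  have hΛn : Λ ^ n * r ≤ ε := by
    rw [← Real.log_le_log_iff (by positivity) hε, Real.log_mul (by positivity) hr0.ne',
      Real.log_pow]
    have := (le_div_iff₀ hL0).1 hnu
    linarith
  refine (measureReal_mono (ball_subset_bowenBall hΛ h hεδ hΛn)).trans ((hn₀ n hnn).trans ?_)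
  rw [Real.rpow_def_of_pos hr0]
  refine Real.exp_le_exp.2 ?_
  rw [div_lt_iff₀ (sub_pos.2 hs)] at h2
  have h3 : (u - 1) * θ ≤ n * θ := by gcongr; linarith
  have h4 : u * θ = θ / L * Real.log ε - θ / L * Real.log r := by rw [hu]; ring
  linarith

theorem eventually_le_ball_of_le_bowenBall {lam δ : ℝ} (hlam : 1 < lam)
    (h : ∀ x y : X, dist x y < δ → lam * dist x y ≤ dist (f x) (f y)) {ε : ℝ} (hε : 0 < ε)
    (hεδ : ε ≤ δ) {x : X} {θ s : ℝ} (hθ : 0 ≤ θ) (hs : θ / Real.log lam < s)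
    (hB : ∀ᶠ n : ℕ in atTop, Real.exp (-(n * θ)) ≤ μ.real (bowenBall f x n ε)) :
    ∀ᶠ r in 𝓝[>] (0 : ℝ), r ^ s ≤ μ.real (Metric.ball x r) := by
  set L := Real.log lam with hL
  have hL0 : 0 < L := Real.log_pos hlam
  obtain ⟨n₀, hn₀⟩ := eventually_atTop.1 hB
  filter_upwards [self_mem_nhdsWithin, eventually_lt_neg_log (L * n₀ - Real.log ε),
    eventually_lt_neg_log ((θ + θ / L * Real.log ε) / (s - θ / L))] with r hr h1 h2
  have hr0 : (0 : ℝ) < r := hr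
  set u : ℝ := (Real.log ε - Real.log r) / L with hu
  have hun : (n₀ : ℝ) ≤ u := by
    rw [hu, le_div_iff₀ hL0]
    linarith
  have hu0 : 0 ≤ u := le_trans (by positivity) hun
  -- Here `u` solves `lam ^ u * r = ε`. It is rounded up because the inclusion needs `ε ≤ lam ^ n *
  -- r`; with the upper bound on expansion it is rounded down.
  set n : ℕ := ⌈u⌉₊ with hn
  have hnu : u ≤ n := Nat.le_ceil u
  have hun' : (n : ℝ) < u + 1 := Nat.ceil_lt_add_one hu0
  have hnn : n₀ ≤ n := by exact_mod_cast hun.trans hnu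
  have hlamn : ε ≤ lam ^ n * r := by
    rw [← Real.log_le_log_iff hε (by positivity), Real.log_mul (by positivity) hr0.ne',
      Real.log_pow]
    have := (div_le_iff₀ hL0).1 hnu
    linarith
  refine le_trans ?_ ((hn₀ n hnn).trans (measureReal_mono (bowenBall_subset_ball hlam h hεδ hlamn)))
  rw [Real.rpow_def_of_pos hr0]
  refine Real.exp_le_exp.2 ?_
  rw [div_lt_iff₀ (sub_pos.2 hs)] at h2
  have h3 : n * θ ≤ (u + 1) * θ := by gcongr
  have h4 : u * θ = θ / L * Real.log ε - θ / L * Real.log r := by rw [hu]; ring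
  linarith

theorem nonneg_of_eventually_exp_le_bowenBall {x : X} {ε θ : ℝ}
    (h : ∀ᶠ n : ℕ in atTop, Real.exp (-(n * θ)) ≤ μ.real (bowenBall f x n ε)) : 0 ≤ θ := by
  obtain ⟨n, hn, hn1⟩ := (h.and (eventually_ge_atTop 1)).exists
  have h1 : -(n * θ) ≤ 0 := Real.exp_le_one_iff.1 (hn.trans measureReal_le_one)
  have h2 : (1 : ℝ) ≤ n := by exact_mod_cast hn1
  by_contra! h3
  nlinarith

end Comparison

/-! ### Logarithms in the extended reals -/

theorem coe_le_neg_log_div_iff {m b θ : ℝ} (hb : 0 < b) :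
    (θ : EReal) ≤ -ENNReal.log (ENNReal.ofReal m) / (b : EReal) ↔ m ≤ Real.exp (-(b * θ)) := by
  rw [EReal.le_div_iff_mul_le (by exact_mod_cast hb) (EReal.coe_ne_top b), EReal.le_neg,
    ← EReal.coe_mul, ← EReal.coe_neg, ← Real.log_exp (-(θ * b)),
    ← ENNReal.log_ofReal_of_pos (Real.exp_pos _), ENNReal.log_le_log_iff,
    ENNReal.ofReal_le_ofReal_iff (Real.exp_pos _).le, mul_comm]

theorem neg_log_div_le_coe_iff {m b θ : ℝ} (hb : 0 < b) :
    -ENNReal.log (ENNReal.ofReal m) / (b : EReal) ≤ (θ : EReal) ↔ Real.exp (-(b * θ)) ≤ m := by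
  rw [EReal.div_le_iff_le_mul (by exact_mod_cast hb) (EReal.coe_ne_top b), EReal.neg_le,
    ← EReal.coe_mul, ← EReal.coe_neg, ← Real.log_exp (-(b * θ)),
    ← ENNReal.log_ofReal_of_pos (Real.exp_pos _), ENNReal.log_le_log_iff, Real.log_exp,
    ENNReal.ofReal_le_ofReal_iff', or_iff_left (Real.exp_pos _).not_ge]

theorem div_coe_eq_neg_div (a : EReal) (b : ℝ) : a / (b : EReal) = -a / ((-b : ℝ) : EReal) := by
  rw [div_eq_mul_inv, div_eq_mul_inv, EReal.coe_neg, EReal.inv_neg, neg_mul_neg]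

theorem coe_le_log_div_log_iff {m r s : ℝ} (hr : 0 < r) (hr1 : r < 1) :
    (s : EReal) ≤ ENNReal.log (ENNReal.ofReal m) / (Real.log r : EReal) ↔ m ≤ r ^ s := by
  rw [div_coe_eq_neg_div, coe_le_neg_log_div_iff (neg_pos.2 (Real.log_neg hr hr1)),
    Real.rpow_def_of_pos hr, neg_mul, neg_neg]

theorem log_div_log_le_coe_iff {m r s : ℝ} (hr : 0 < r) (hr1 : r < 1) :
    ENNReal.log (ENNReal.ofReal m) / (Real.log r : EReal) ≤ (s : EReal) ↔ r ^ s ≤ m := by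
  rw [div_coe_eq_neg_div, neg_log_div_le_coe_iff (neg_pos.2 (Real.log_neg hr hr1)),
    Real.rpow_def_of_pos hr, neg_mul, neg_neg]

theorem div_coe_le_of_forall_lt {a b : EReal} {L : ℝ} (hL : 0 < L)
    (h : ∀ z : ℝ, (z : EReal) < a → ((z / L : ℝ) : EReal) ≤ b) : a / (L : EReal) ≤ b := by
  refine EReal.ge_of_forall_gt_iff_ge.1 fun q hq => ?_
  rw [EReal.lt_div_iff (by exact_mod_cast hL) (EReal.coe_ne_top L), ← EReal.coe_mul] at hq
  simpa [hL.ne'] using h _ hq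

theorem le_div_coe_of_forall_gt {a b : EReal} {L : ℝ} (hL : 0 < L)
    (h : ∀ z : ℝ, a < (z : EReal) → b ≤ ((z / L : ℝ) : EReal)) : b ≤ a / (L : EReal) := by
  refine EReal.le_of_forall_lt_iff_le.1 fun q hq => ?_
  rw [EReal.div_lt_iff (by exact_mod_cast hL) (EReal.coe_ne_top L), ← EReal.coe_mul] at hq
  simpa [hL.ne'] using h _ hq

/-! ### Local dimensions and local entropies -/

section Local

variable {X : Type*} [MetricSpace X] [MeasurableSpace X] {f : X → X} {μ : Measure X}
  [IsProbabilityMeasure μ]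

theorem lowerLocalEntropy_div_le_lowerLocalDim {Λ δ : ℝ} (hΛ : 1 < Λ) (hδ : 0 < δ)
    (h : ∀ x y : X, dist x y < δ → dist (f x) (f y) ≤ Λ * dist x y) (x : X) :
    lowerLocalEntropy f μ x / (Real.log Λ : EReal) ≤ lowerLocalDim μ x := by
  unfold lowerLocalDim
  split_ifs with hpos
  swap
  · exact le_top
  refine div_coe_le_of_forall_lt (Real.log_pos hΛ) fun z hz => ?_
  simp only [lowerLocalEntropy, lt_iSup_iff] at hz
  obtain ⟨ε, hε, hz⟩ := hz
  -- The comparison of scales needs a nonnegative rate; for `z ≤ 0` the rate 0 is free, since masses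
  -- are at most 1. The radius is cut down to `δ`, where the expansion bound applies.
  have hB : ∀ᶠ n : ℕ in atTop,
      μ.real (bowenBall f x n (min ε δ)) ≤ Real.exp (-(n * max z 0)) := by
    filter_upwards [eventually_lt_of_lt_liminf hz, eventually_ge_atTop 1] with n hn hn1
    have hn0 : (0 : ℝ) < n := by exact_mod_cast hn1
    have h1 : μ.real (bowenBall f x n ε) ≤ Real.exp (-(n * z)) := by
      rw [← coe_le_neg_log_div_iff hn0, ofReal_measureReal]
      exact_mod_cast hn.le
    have h2 : μ.real (bowenBall f x n (min ε δ)) ≤ μ.real (bowenBall f x n ε) :=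
      measureReal_mono fun y hy i hi => (hy i hi).trans_le (min_le_left _ _)
    rcases le_total z 0 with hz0 | hz0
    · simp [max_eq_right hz0]
    · rw [max_eq_left hz0]
      exact h2.trans h1
  refine EReal.ge_of_forall_gt_iff_ge.1 fun s hs => ?_
  have hs' : s < max z 0 / Real.log Λ := by
    refine lt_of_lt_of_le (by exact_mod_cast hs) ?_
    have := Real.log_pos hΛ
    gcongr
    exact le_max_left _ _
  refine le_liminf_of_le (by isBoundedDefault) ?_
  filter_upwards [eventually_ball_le_of_bowenBall_le hΛ h (lt_min hε hδ) (min_le_right _ _)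
    (le_max_right _ _) hs' hB, Ioo_mem_nhdsGT one_pos] with r hr hr1
  rwa [← coe_le_log_div_log_iff hr1.1 hr1.2, ofReal_measureReal] at hr

theorem upperLocalDim_le_upperLocalEntropy_div {lam δ : ℝ} (hlam : 1 < lam) (hδ : 0 < δ)
    (h : ∀ x y : X, dist x y < δ → lam * dist x y ≤ dist (f x) (f y)) (x : X) :
    upperLocalDim μ x ≤ upperLocalEntropy f μ x / (Real.log lam : EReal) := by
  refine le_div_coe_of_forall_gt (Real.log_pos hlam) fun z hz => ?_
  have hz' : upperLocalEntropyAt f μ x δ < z := lt_of_le_of_lt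
    (le_iSup₂ (f := fun (ε : ℝ) (_ : 0 < ε) => upperLocalEntropyAt f μ x ε) δ hδ) hz
  have hB : ∀ᶠ n : ℕ in atTop, Real.exp (-(n * z)) ≤ μ.real (bowenBall f x n δ) := by
    filter_upwards [eventually_lt_of_limsup_lt hz', eventually_ge_atTop 1] with n hn hn1
    have hn0 : (0 : ℝ) < n := by exact_mod_cast hn1
    rw [← neg_log_div_le_coe_iff hn0, ofReal_measureReal]
    exact_mod_cast hn.le
  refine EReal.le_of_forall_lt_iff_le.1 fun s hs => ?_
  have hball := eventually_le_ball_of_le_bowenBall hlam h hδ le_rfl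
    (nonneg_of_eventually_exp_le_bowenBall hB) (by exact_mod_cast hs) hB
  -- A finite upper bound `z` on the entropy already makes all balls about `x` non-null, so the
  -- value `⊤` of the upper local dimension does not arise.
  have hpos : ∀ ε : ℝ, 0 < ε → 0 < μ (Metric.ball x ε) := by
    intro ε hε
    obtain ⟨r, hr, hr0, hrε⟩ := (hball.and (Ioo_mem_nhdsGT hε)).exists
    have h1 : 0 < μ.real (Metric.ball x r) := (Real.rpow_pos_of_pos hr0 s).trans_le hr
    exact (ENNReal.toReal_pos_iff.1 h1).1.trans_le (measure_mono (Metric.ball_subset_ball hrε.le))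
  rw [upperLocalDim, if_pos hpos]
  refine limsup_le_of_le (by isBoundedDefault) ?_
  filter_upwards [hball, Ioo_mem_nhdsGT one_pos] with r hr hr1
  rwa [← log_div_log_le_coe_iff hr1.1 hr1.2, ofReal_measureReal] at hr

end Local

/-! ### Mass distribution principles -/

section MassDistribution

variable {X : Type*} [MetricSpace X] [MeasurableSpace X] [BorelSpace X] {μ : Measure X}
  [IsProbabilityMeasure μ]

/-- A small set meeting `A` has its closure inside balls about a point of `A` with radii decreasing
to its diameter, so its mass is at most its diameter to the power `s`, with constant 1. -/
theorem le_hausdorffMeasure_of_ball_le {s η : ℝ} (hs : 0 ≤ s) (hη : 0 < η) {A : Set X}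
    (hA : ∀ x ∈ A, ∀ r ∈ Ioo 0 η, μ.real (Metric.ball x r) ≤ r ^ s) : μ A ≤ μH[s] A := by
  have key : μ.restrict A ≤ μH[s] := by
    refine Measure.le_hausdorffMeasure s _ (ENNReal.ofReal (η / 2)) (by simpa using hη) ?_
    intro S hS
    refine (measure_mono subset_closure).trans ?_
    rw [Measure.restrict_apply isClosed_closure.measurableSet]
    rcases (closure S ∩ A).eq_empty_or_nonempty with hemp | ⟨x, hxS, hxA⟩
    · simp [hemp]
    have htop : Metric.ediam S ≠ ∞ := ne_top_of_le_ne_top ENNReal.ofReal_ne_top hS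
    set d := (Metric.ediam S).toReal with hd
    have hd0 : 0 ≤ d := ENNReal.toReal_nonneg
    have hdη : d < η := by
      have : d ≤ η / 2 := ENNReal.toReal_le_of_le_ofReal (by positivity) hS
      linarith
    have hsub : ∀ r, d < r → closure S ⊆ Metric.ball x r := by
      intro r hr y hy
      have h1 := Metric.edist_le_ediam_of_mem hy hxS
      rw [Metric.ediam_closure, edist_dist] at h1
      exact (ENNReal.ofReal_le_iff_le_toReal htop |>.1 h1).trans_lt hr
    have hlim : Tendsto (fun r : ℝ => r ^ s) (𝓝[>] d) (𝓝 (d ^ s)) :=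
      ((Real.continuous_rpow_const hs).tendsto d).mono_left nhdsWithin_le_nhds
    have h2 : μ.real (closure S) ≤ d ^ s := by
      refine ge_of_tendsto hlim ?_
      filter_upwards [Ioo_mem_nhdsGT hdη] with r hr
      exact (measureReal_mono (hsub r hr.1)).trans (hA x hxA r ⟨hd0.trans_lt hr.1, hr.2⟩)
    calc μ (closure S ∩ A) ≤ μ (closure S) := measure_mono inter_subset_left
      _ = ENNReal.ofReal (μ.real (closure S)) := by rw [ofReal_measureReal]
      _ ≤ ENNReal.ofReal (d ^ s) := ENNReal.ofReal_le_ofReal h2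
      _ = Metric.ediam S ^ s := by
        rw [← ENNReal.ofReal_rpow_of_nonneg hd0 hs, hd, ENNReal.ofReal_toReal htop]
  simpa using key A

theorem exists_nat_forall_Ioo_of_eventually {p : ℝ → Prop} (h : ∀ᶠ r in 𝓝[>] (0 : ℝ), p r) :
    ∃ m : ℕ, ∀ r ∈ Ioo (0 : ℝ) (1 / (m + 1)), p r := by
  obtain ⟨u, hu, h⟩ := mem_nhdsGT_iff_exists_Ioo_subset.1 h
  obtain ⟨m, hm⟩ := exists_nat_one_div_lt (mem_Ioi.1 hu)
  exact ⟨m, fun r hr => h ⟨hr.1, hr.2.trans hm⟩⟩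

/-- The eventual bound is uniform on each of countably many pieces of `E`, and one of them has
positive outer measure. The mass distribution principle applied to it bounds the dimension of `E`
from below. -/
theorem le_lowerDimH_of_ae_ball_le {s : ℝ≥0}
    (h : ∀ᵐ x ∂μ, ∀ᶠ r in 𝓝[>] (0 : ℝ), μ.real (Metric.ball x r) ≤ r ^ (s : ℝ)) :
    (s : ℝ≥0∞) ≤ lowerDimH μ := by
  refine le_iInf fun E => le_iInf₂ fun _ hE => ?_
  set A : ℕ → Set X := fun m =>
    {x ∈ E | ∀ r ∈ Ioo (0 : ℝ) (1 / (m + 1)), μ.real (Metric.ball x r) ≤ r ^ (s : ℝ)} with hA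
  have hex : ∃ m, μ (A m) ≠ 0 := by
    by_contra! hcon
    refine hE.ne' (measure_mono_null ?_ (measure_union_null h (measure_iUnion_null hcon)))
    intro x hx
    by_cases hxr : ∀ᶠ r in 𝓝[>] (0 : ℝ), μ.real (Metric.ball x r) ≤ r ^ (s : ℝ)
    · obtain ⟨m, hm⟩ := exists_nat_forall_Ioo_of_eventually hxr
      exact Or.inr (mem_iUnion.2 ⟨m, hx, hm⟩)
    · exact Or.inl hxr
  obtain ⟨m, hm⟩ := hex
  have h1 := le_hausdorffMeasure_of_ball_le (μ := μ) (A := A m) s.2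
    (show (0 : ℝ) < 1 / (m + 1) by positivity) fun x hx => hx.2
  exact (le_dimH_of_hausdorffMeasure_ne_zero (pos_iff_ne_zero.2 hm |>.trans_le h1).ne').trans
    (dimH_mono fun x hx => hx.1)

/-- Disjoint balls have total mass at most 1, so a packing has bounded sum in the exponent `s'`; the
strict gap `s' < s` contributes a factor `δ ^ (s - s')` tending to 0. -/
theorem packingPremeasure_eq_zero_of_le_ball {s : ℝ≥0} {s' η : ℝ} (hs : s' < s)
    (hη : 0 < η) {A : Set X}
    (hA : ∀ x ∈ A, ∀ r ∈ Ioo 0 η, r ^ s' ≤ μ.real (Metric.ball x r)) :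
    packingPremeasure s A = 0 := by
  have hbound : ∀ δ ∈ Ioo 0 η, packingPremeasure s A ≤
      ENNReal.ofReal (δ ^ ((s : ℝ) - s') * 2 ^ s') := by
    intro δ hδ
    refine iInf₂_le_of_le δ hδ.1 (iSup₂_le fun t ht => ?_)
    have hterm : ∀ p : t, ENNReal.ofReal (2 * p.1.2) ^ (s : ℝ) ≤
        ENNReal.ofReal (δ ^ ((s : ℝ) - s') * 2 ^ s') * μ (Metric.closedBall p.1.1 p.1.2) := by
      intro p
      obtain ⟨hpA, hp0, hpδ⟩ := ht.2.1 p.1 p.2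
      have h1 := hA _ hpA p.1.2 ⟨hp0, by linarith [hδ.2]⟩
      have h2 : (2 * p.1.2) ^ (s : ℝ) ≤
          δ ^ ((s : ℝ) - s') * 2 ^ s' * μ.real (Metric.closedBall p.1.1 p.1.2) := by
        calc (2 * p.1.2) ^ (s : ℝ) = (2 * p.1.2) ^ ((s : ℝ) - s') * (2 * p.1.2) ^ s' := by
              rw [← Real.rpow_add (by positivity), sub_add_cancel]
          _ = (2 * p.1.2) ^ ((s : ℝ) - s') * 2 ^ s' * p.1.2 ^ s' := by
              rw [Real.mul_rpow (z := s') zero_le_two hp0.le, mul_assoc]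
          _ ≤ δ ^ ((s : ℝ) - s') * 2 ^ s' * μ.real (Metric.closedBall p.1.1 p.1.2) := by
              have h3 := sub_pos.2 hs
              have h4 := hδ.1.le
              gcongr
              exact h1.trans (measureReal_mono Metric.ball_subset_closedBall)
      rw [ENNReal.ofReal_rpow_of_pos (by positivity), ← ofReal_measureReal,
        ← ENNReal.ofReal_mul (by have := hδ.1; positivity)]
      exact ENNReal.ofReal_le_ofReal h2
    refine (ENNReal.tsum_le_tsum hterm).trans ?_
    rw [ENNReal.tsum_mul_left]
    refine mul_le_of_le_one_right zero_le ?_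
    rw [← measure_biUnion ht.1 ht.2.2 fun p _ => Metric.isClosed_closedBall.measurableSet]
    exact prob_le_one
  have hlim : Tendsto (fun δ : ℝ => ENNReal.ofReal (δ ^ ((s : ℝ) - s') * 2 ^ s')) (𝓝[>] 0)
      (𝓝 0) := by
    have h1 : Tendsto (fun δ : ℝ => δ ^ ((s : ℝ) - s') * 2 ^ s') (𝓝 0)
        (𝓝 (0 ^ ((s : ℝ) - s') * 2 ^ s')) :=
      ((Real.continuous_rpow_const (sub_pos.2 hs).le).tendsto 0).mul_const _
    rw [Real.zero_rpow (sub_pos.2 hs).ne', zero_mul] at h1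
    simpa using (ENNReal.tendsto_ofReal h1).mono_left nhdsWithin_le_nhds
  refine le_antisymm (ge_of_tendsto hlim ?_) zero_le
  filter_upwards [Ioo_mem_nhdsGT hη] with δ hδ
  exact hbound δ hδ

/-- The complement of a measurable hull of the exceptional null set is Borel of full measure, and it
is covered by countably many pieces on which the lower ball bound is uniform. -/
theorem upperDimP_le_of_ae_le_ball {s : ℝ≥0} {s' : ℝ} (hs : s' < s)
    (h : ∀ᵐ x ∂μ, ∀ᶠ r in 𝓝[>] (0 : ℝ), r ^ s' ≤ μ.real (Metric.ball x r)) :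
    upperDimP μ ≤ s := by
  set N : Set X := {x | ¬ ∀ᶠ r in 𝓝[>] (0 : ℝ), r ^ s' ≤ μ.real (Metric.ball x r)} with hN
  have hN0 : μ N = 0 := h
  set A : ℕ → Set X := fun m =>
    {x | ∀ r ∈ Ioo (0 : ℝ) (1 / (m + 1)), r ^ s' ≤ μ.real (Metric.ball x r)} with hA
  have hsub : (toMeasurable μ N)ᶜ ⊆ ⋃ m, A m := by
    intro x hx
    have hx' : x ∉ N := fun hxN => hx (subset_toMeasurable μ N hxN)
    obtain ⟨m, hm⟩ := exists_nat_forall_Ioo_of_eventually (not_not.1 hx')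
    exact mem_iUnion.2 ⟨m, hm⟩
  refine iInf_le_of_le (toMeasurable μ N)ᶜ (iInf₂_le_of_le
    (measurableSet_toMeasurable μ N).compl (by rw [compl_compl, measure_toMeasurable, hN0])
    (iInf₂_le s ?_))
  refine le_antisymm ((iInf₂_le A hsub).trans (le_of_eq ?_)) zero_le
  refine ENNReal.tsum_eq_zero.2 fun m => ?_
  exact packingPremeasure_eq_zero_of_le_ball hs
    (show (0 : ℝ) < 1 / (m + 1) by positivity) fun x hx => hx

end MassDistribution

/-! ### Dimensions of ergodic measures -/

theorem metricEntropy_div_le_lowerDimH {X : Type*} [MetricSpace X] [CompleteSpace X]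
    [SecondCountableTopology X] [MeasurableSpace X] [BorelSpace X] {f : X → X}
    (hf : Continuous f) {μ : Measure X} [IsProbabilityMeasure μ] (hμ : Ergodic f μ) {Λ δ : ℝ}
    (hΛ : 1 < Λ) (hδ : 0 < δ) (h : ∀ x y : X, dist x y < δ → dist (f x) (f y) ≤ Λ * dist x y) :
    metricEntropy f μ / (Real.log Λ : EReal) ≤ (lowerDimH μ : EReal) := by
  have hL := Real.log_pos hΛ
  refine div_coe_le_of_forall_lt hL fun z hz => ?_
  refine EReal.ge_of_forall_gt_iff_ge.1 fun s hs => ?_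
  have hs' : s < z / Real.log Λ := by exact_mod_cast hs
  rcases lt_or_ge s 0 with hs0 | hs0
  · exact le_trans (by exact_mod_cast hs0.le) (EReal.coe_ennreal_nonneg _)
  lift s to ℝ≥0 using hs0
  have hz0 : 0 ≤ z := by
    rw [lt_div_iff₀ hL] at hs'
    exact le_trans (by positivity) hs'.le
  obtain ⟨ε, hε, hB⟩ := exists_ae_eventually_bowenBall_le hf hμ hz0 hz
  have : (s : ℝ≥0∞) ≤ lowerDimH μ := by
    refine le_lowerDimH_of_ae_ball_le ?_
    filter_upwards [hB] with x hx
    refine eventually_ball_le_of_bowenBall_le hΛ h (lt_min hε hδ) (min_le_right _ _) hz0 hs' ?_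
    filter_upwards [hx] with n hn
    exact (measureReal_mono fun y hy i hi => (hy i hi).trans_le (min_le_left _ _)).trans hn
  rw [← EReal.coe_nnreal_eq_coe_real]
  exact EReal.coe_ennreal_le_coe_ennreal_iff.2 this

theorem upperDimP_le_metricEntropy_div {X : Type*} [MetricSpace X] [CompactSpace X]
    [MeasurableSpace X] [BorelSpace X] {f : X → X} {μ : Measure X} [IsProbabilityMeasure μ]
    (hμ : Ergodic f μ) {lam δ : ℝ} (hlam : 1 < lam) (hδ : 0 < δ)
    (h : ∀ x y : X, dist x y < δ → lam * dist x y ≤ dist (f x) (f y)) :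
    (upperDimP μ : EReal) ≤ metricEntropy f μ / (Real.log lam : EReal) := by
  have hL := Real.log_pos hlam
  refine le_div_coe_of_forall_gt hL fun z hz => ?_
  refine EReal.le_of_forall_lt_iff_le.1 fun s hs => ?_
  have hs' : z / Real.log lam < s := by exact_mod_cast hs
  have hB := ae_eventually_exp_le_bowenBall hμ hz hδ
  obtain ⟨x₀, hx₀⟩ := hB.exists
  have hz0 := nonneg_of_eventually_exp_le_bowenBall hx₀
  have hzL : 0 ≤ z / Real.log lam := by positivity
  -- The exponent is lowered twice: from `s` to `s'` to make the packing measure vanish, and from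
  -- `s'` to `z / log lam` to absorb constants when passing from Bowen balls to balls.
  obtain ⟨s', hzs', hs's⟩ := exists_between hs'
  lift s to ℝ≥0 using hzL.trans hs'.le
  have : upperDimP μ ≤ (s : ℝ≥0∞) := by
    refine upperDimP_le_of_ae_le_ball hs's ?_
    filter_upwards [hB] with x hx
    exact eventually_le_ball_of_le_bowenBall hlam h hδ le_rfl hz0 hzs' hx
  rw [← EReal.coe_nnreal_eq_coe_real]
  exact EReal.coe_ennreal_le_coe_ennreal_iff.2 this

end

end InvariantMeasure

theorem lemma2p1 {X : Type*} [MetricSpace X] [CompleteSpace X] [SecondCountableTopology X]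
    [MeasurableSpace X] [BorelSpace X] (f : X → X) (hf : Continuous f)
    (μ : Measure X) [IsProbabilityMeasure μ] (hμ : MeasurePreserving f μ μ) :
    (∀ Λ δ : ℝ, 1 < Λ → 0 < δ →
      (∀ x y : X, dist x y < δ → dist (f x) (f y) ≤ Λ * dist x y) →
        (∀ x : X, InvariantMeasure.lowerLocalEntropy f μ x / (Real.log Λ : EReal)
            ≤ InvariantMeasure.lowerLocalDim μ x) ∧
        (Ergodic f μ → InvariantMeasure.metricEntropy f μ / (Real.log Λ : EReal)
            ≤ (InvariantMeasure.lowerDimH μ : EReal))) ∧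
    (∀ lam δ : ℝ, 1 < lam → 0 < δ →
      (∀ x y : X, dist x y < δ → lam * dist x y ≤ dist (f x) (f y)) →
        (∀ x : X, InvariantMeasure.upperLocalDim μ x
            ≤ InvariantMeasure.upperLocalEntropy f μ x / (Real.log lam : EReal)) ∧
        (CompactSpace X → Ergodic f μ → (InvariantMeasure.upperDimP μ : EReal)
            ≤ InvariantMeasure.metricEntropy f μ / (Real.log lam : EReal))) :=
  ⟨fun _ _ hΛ hδ h =>
    ⟨InvariantMeasure.lowerLocalEntropy_div_le_lowerLocalDim hΛ hδ h,
      fun herg => InvariantMeasure.metricEntropy_div_le_lowerDimH hf herg hΛ hδ h⟩,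
    fun _ _ hlam hδ h =>
    ⟨InvariantMeasure.upperLocalDim_le_upperLocalEntropy_div hlam hδ h,
      fun _ herg => InvariantMeasure.upperDimP_le_metricEntropy_div herg hlam hδ h⟩⟩
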